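/- **Setting.** Let $\mathcal X$ be a measurable space with a reference measure $dx$, let $\mathcal H$ be a reproducing kernel Hilbert space (norm $\|\cdot\|$) of real functions on $\mathcal X$, and let $\mathcal Q=\mathbb R^p\times\mathcal H$. For $\tau=(\theta,h)\in\mathcal Q$ let $\eta(\tau)=\eta(\cdot;\theta,h)=\alpha(\cdot;\theta)+h$ with a known $\alpha$, let $f_\tau=e^{\eta(\tau)}/\int e^{\eta(\tau)}dx$, and let $\mu_\tau$ and $V_\tau$ denote expectation and (co)variance under $f_\tau$. Let $\tau_0=(\theta_0,h_0)\in\mathcal Q$ be the true parameter and let $L_0^2(\mathcal X)$ be the space of mean-zero functions in $L^2(f_{\tau_0}dx)$; $\eta$ takes its values in $L^2_0(\mathcal X)$. Let $X_1,X_2,\dots$ be i.i.d. with density $f_{\tau_0}$, and put $$\mathfrak L_n(\tau)=-\frac1n\sum_{i=1}^n\eta(X_i;\tau)+\log\int e^{\eta(x;\tau)}dx,\qquad \mathfrak L_{n,\lambda}(\tau)=\mathfrak L_n(\tau)+\tfrac\lambda2J(h).$$ **Assumptions.** $\mathcal N=\mathcal N_{\theta_0}\times\mathcal N_{h_0}$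 is a convex product of open neighbourhoods of $\theta_0$ and $h_0$, the densities $f_\tau$, $\tau\in\mathcal N$, exist, and: 1. $J$ is a (finite) square seminorm on $\mathcal H$ with finite-dimensional null space; $J(\cdot,\cdot)$ is its semi-inner product. 2. $L_\theta:\mathbb R^p\to L_0^2(\mathcal X)$ and $L_h:\mathcal H\to L^2_0(\mathcal X)$ are bounded linear operators with zero null spaces such that (i) for every $\lambda>0$ there are $M_1,M_2>0$ with $M_1\|g\|^2\le V_{\tau_0}(L_hg)+\lambda J(g)\le M_2\|g\|^2$ for all $g\in\mathcal H$; (ii) there is $c_\delta>0$ with $V_{\tau_0}(L_\theta\zeta-L_hg)>c_\delta$ for all $g\in\mathcal H$ and all $\zeta\in\mathbb R^p$ with $\|\zeta\|_{l^2}=1$. 3. On $\mathcal N$ the map $\eta$ into $L_0^2(\mathcal X)$ is one-to-one and three times continuously Fréchet differentiable, and $\tau_0$ is the only root in $\mathcal N$ of the expected score equations $\mu_\tau[D_\theta\eta(\tau)\zeta]-\mu_{\tau_0}[D_\theta\eta(\tau)\zeta]=0$ for all $\zeta\in\mathbb R^p$, $\mu_\tau[D_h\eta(\tau)g]-\mu_{\tau_0}[D_h\eta(\tau)g]=0$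 for all $g\in\mathcal H$. 4. There are $C_1,C_2>0$ such that for all $\tau_*\in\mathcal N$ and $(\zeta,g)\in\mathcal Q$: $C_1V_{\tau_0}(L_\theta\zeta+L_hg)\le V_{\tau_0}(D_\theta\eta(\tau_*)\zeta+D_h\eta(\tau_*)g)\le C_2V_{\tau_0}(L_\theta\zeta+L_hg)$. 5. For all $\tau_1,\tau_2\in\mathcal N$ there is $C_d\in(0,2C_1)$ such that for all $(\zeta,g)\in\mathcal N$: $V_{\tau_0}[(D_\theta\eta(\tau_1)-D_\theta\eta(\tau_2))\zeta+(D_h\eta(\tau_1)-D_h\eta(\tau_2))g]\le C_dV_{\tau_0}(L_\theta\zeta+L_hg)$. 6. There are $C_3,C_4>0$ such that for all $\tau\in\mathcal N$ and $f\in L_0^2(\mathcal X)$ the variance $V_\tau(f)$ is finite and $C_3V_{\tau_0}(f)\le V_\tau(f)\le C_4V_{\tau_0}(f)$. 7. $g\mapsto V_{\tau_0}(L_hg)$ is completely continuous with respect to $J$: for every $\varepsilon>0$ there are finitely many bounded linear functionals on $\mathcal H$ such that $V_{\tau_0}(L_hg)\le\varepsilon J(g)$ whenever they all vanish at $g$.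 8. For the complete system of eigenfunctions $\phi_\nu$ and eigenvalues $\rho_\nu$ ($\nu\ge1$) of this pair, $V_{\tau_0}(L_h\phi_\nu,L_h\phi_\mu)=\delta_{\nu\mu}$, $J(\phi_\nu,\phi_\mu)=\rho_\nu\delta_{\nu\mu}$, we have $\rho_\nu=\kappa_\nu\nu^r$ for all sufficiently large $\nu$, where $r>1$ and $\kappa_\nu\in(\beta_1,\beta_2)\subset(0,\infty)$. 9. With probability tending to one as $n\to\infty$, $\mathfrak L_n$ is convex on $\mathcal N$, and $\hat\tau=(\hat\theta,\hat h)\in\mathcal N$ is the unique local minimum of $\mathfrak L_{n,\lambda}$ in $\mathcal N$. **Claim.** The operator $L_h$ can be chosen to be the inclusion $\iota:\mathcal H\to L_0^2(\mathcal X)$: $\iota$ is a bounded linear operator which, together with some bounded linear operator $L_\theta':\mathbb R^p\to L_0^2(\mathcal X)$, satisfies 2 and (for some positive constants) 4, and which satisfies 7. If $\|\cdot\|_{\mathcal H}$ denotes the norm $\|g\|_{\mathcal H}=[V_{\tau_0}(\iota g)+\lambda J(g)]^{1/2}$ given by this choice, then, as $n\to\infty$, $\lambda=\lambda_n\to0$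 ($\lambda_n>0$) and $n\lambda^{1/r}\to\infty$, $$\|\hat h-h_0\|_{\mathcal H}=[V_{\tau_0}(\hat h-h_0)+\lambda J(\hat h-h_0)]^{1/2}=O_p\big(n^{-1/2}\lambda^{-1/(2r)}+\lambda^{1/2}\big).$$ -/

import Mathlib

open MeasureTheory ProbabilityTheory Filter Topology

namespace SemiparDensity

noncomputable section

/-! ### The space of centred square-integrable functions -/

/-- `f` is square integrable with respect to `μ` and has mean zero. -/
def MemL20 {𝒳 : Type*} [MeasurableSpace 𝒳] (μ : Measure 𝒳) (f : 𝒳 → ℝ) : Prop :=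
  MemLp f 2 μ ∧ ∫ x, f x ∂μ = 0

/-- `L²₀(μ) = L²(μ) ⊖ {1}`: the closed subspace of mean-zero elements of `L²(μ)`, with the
`L²(μ)` norm. -/
def L20 {𝒳 : Type*} [MeasurableSpace 𝒳] (μ : Measure 𝒳) [IsFiniteMeasure μ] :
    Submodule ℝ (Lp ℝ 2 μ) where
  carrier := {f | ∫ x, f x ∂μ = 0}
  zero_mem' := by
    show ∫ x, (0 : Lp ℝ 2 μ) x ∂μ = 0
    rw [integral_congr_ae (Lp.coeFn_zero ℝ 2 μ)]
    simp
  add_mem' := by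
    intro f g hf hg
    have hfi : Integrable f μ := (Lp.memLp f).integrable (by norm_num)
    have hgi : Integrable g μ := (Lp.memLp g).integrable (by norm_num)
    show ∫ x, (f + g : Lp ℝ 2 μ) x ∂μ = 0
    rw [integral_congr_ae (Lp.coeFn_add f g)]
    simp only [Pi.add_apply]
    rw [integral_add hfi hgi]
    simp only [Set.mem_ofPred_eq] at hf hg
    rw [hf, hg, add_zero]
  smul_mem' := by
    intro c f hf
    show ∫ x, (c • f : Lp ℝ 2 μ) x ∂μ = 0
    rw [integral_congr_ae (Lp.coeFn_smul c f)]
    simp only [Pi.smul_apply, integral_smul]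
    simp only [Set.mem_ofPred_eq] at hf
    rw [hf, smul_zero]

/-- A representative of an element of `L²₀(μ)`. -/
def L20fn {𝒳 : Type*} [MeasurableSpace 𝒳] {μ : Measure 𝒳} [IsFiniteMeasure μ] (f : L20 μ) :
    𝒳 → ℝ :=
  ((f : Lp ℝ 2 μ) : 𝒳 → ℝ)

/-- The class in `L²₀(μ)` of a centred square-integrable function. -/
def MemL20.toL20 {𝒳 : Type*} [MeasurableSpace 𝒳] {μ : Measure 𝒳} [IsFiniteMeasure μ]
    {f : 𝒳 → ℝ} (hf : MemL20 μ f) : L20 μ :=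
  ⟨hf.1.toLp f, by
    show ∫ x, (hf.1.toLp f) x ∂μ = 0
    rw [integral_congr_ae hf.1.coeFn_toLp]
    exact hf.2⟩

/-- Variance `V_{τ₀}(f)` of an element of `L²₀(μ)`. -/
def V {𝒳 : Type*} [MeasurableSpace 𝒳] {μ : Measure 𝒳} [IsFiniteMeasure μ] (f : L20 μ) : ℝ :=
  Var[L20fn f; μ]

/-- Covariance `V_{τ₀}(f, g)` of two elements of `L²₀(μ)`. -/
def Vcov {𝒳 : Type*} [MeasurableSpace 𝒳] {μ : Measure 𝒳} [IsFiniteMeasure μ] (f g : L20 μ) : ℝ :=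
  cov[L20fn f, L20fn g; μ]

/-! ### Likelihood and estimator

Below `E` is the space of the parameter `θ`, `H` the space of the function `h`, and
`η : E × H → 𝒳 → ℝ` is the logistic transformation of the density. For a parameter `τ`, the model
distribution, with density `exp (η τ) / ∫ exp (η τ) dν` with respect to `ν`, is `ν.tilted (η τ)`. -/

/-- The normalized negative log likelihood `-n⁻¹ ∑_{i<n} η(xᵢ; τ) + log ∫ exp (η(x; τ)) dν(x)`. -/
def negLogLik {E H 𝒳 : Type*} [MeasurableSpace 𝒳] (ν : Measure 𝒳) (η : E × H → 𝒳 → ℝ)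
    (x : ℕ → 𝒳) (n : ℕ) (τ : E × H) : ℝ :=
  -((n : ℝ)⁻¹ * ∑ i ∈ Finset.range n, η τ (x i)) + Real.log (∫ y, Real.exp (η τ y) ∂ν)

/-- The penalized likelihood, with penalty `(lam / 2) J(h)`. -/
def penLik {E H 𝒳 : Type*} [AddCommGroup H] [Module ℝ H] [MeasurableSpace 𝒳] (ν : Measure 𝒳)
    (η : E × H → 𝒳 → ℝ) (J : LinearMap.BilinForm ℝ H) (lam : ℝ) (x : ℕ → 𝒳) (n : ℕ)
    (τ : E × H) : ℝ :=
  negLogLik ν η x n τ + lam / 2 * J τ.2 τ.2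

/-- `τhat` is the estimator for the sample `x 0, …, x (n - 1)`: the negative log likelihood is convex
on `N`, and `τhat ∈ N` is the unique local minimum in `N` of the penalized likelihood. -/
structure IsEstimator {E H 𝒳 : Type*} [NormedAddCommGroup E] [NormedSpace ℝ E]
    [NormedAddCommGroup H] [NormedSpace ℝ H] [MeasurableSpace 𝒳] (ν : Measure 𝒳)
    (η : E × H → 𝒳 → ℝ) (J : LinearMap.BilinForm ℝ H) (N : Set (E × H)) (lam : ℝ) (x : ℕ → 𝒳)
    (n : ℕ) (τhat : E × H) : Prop where
  convexOn : ConvexOn ℝ N (negLogLik ν η x n)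
  mem : τhat ∈ N
  isLocalMinOn : IsLocalMinOn (penLik ν η J lam x n) N τhat
  unique : ∀ τ ∈ N, IsLocalMinOn (penLik ν η J lam x n) N τ → τ = τhat

/-! ### Fréchet partial derivatives of an `L²₀`-valued map -/

/-- Fréchet partial derivative with respect to `θ`. -/
def Dθ {E H G : Type*} [NormedAddCommGroup E] [NormedSpace ℝ E] [NormedAddCommGroup G]
    [NormedSpace ℝ G] (F : E × H → G) (τ : E × H) : E →L[ℝ] G :=
  fderiv ℝ (fun θ => F (θ, τ.2)) τ.1

/-- Fréchet partial derivative with respect to `h`. -/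
def Dh {E H G : Type*} [NormedAddCommGroup H] [NormedSpace ℝ H] [NormedAddCommGroup G]
    [NormedSpace ℝ G] (F : E × H → G) (τ : E × H) : H →L[ℝ] G :=
  fderiv ℝ (fun h => F (τ.1, h)) τ.2

/-! ### Regularity conditions -/

/-- `J` is (the semi-inner product of) a square seminorm with finite-dimensional null space. -/
def PenaltyCondition {H : Type*} [AddCommGroup H] [Module ℝ H] (J : LinearMap.BilinForm ℝ H) :
    Prop :=
  J.IsPosSemidef ∧
    ∃ H₀ : Submodule ℝ H, FiniteDimensional ℝ H₀ ∧ ∀ h : H, h ∈ H₀ ↔ J h h = 0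

/-- The condition on the auxiliary operators `Lθ`, `Lh`: zero null spaces; for each value of the
smoothing parameter, `V(Lh g) + lam J(g)` is equivalent to `‖g‖²`; and `V(Lθ ζ - Lh g)` is bounded
away from zero on unit vectors `ζ`, uniformly in `g`. -/
structure OperatorCondition {E H 𝒳 : Type*} [NormedAddCommGroup E] [NormedSpace ℝ E]
    [NormedAddCommGroup H] [NormedSpace ℝ H] [MeasurableSpace 𝒳] {μ : Measure 𝒳}
    [IsFiniteMeasure μ] (J : LinearMap.BilinForm ℝ H) (Lθ : E →L[ℝ] L20 μ) (Lh : H →L[ℝ] L20 μ) :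
    Prop where
  injective_Lθ : Function.Injective Lθ
  injective_Lh : Function.Injective Lh
  norm_equiv : ∀ lam : ℝ, 0 < lam → ∃ M₁ M₂ : ℝ, 0 < M₁ ∧ 0 < M₂ ∧ ∀ g : H,
    M₁ * ‖g‖ ^ 2 ≤ V (Lh g) + lam * J g g ∧ V (Lh g) + lam * J g g ≤ M₂ * ‖g‖ ^ 2
  separation : ∃ cδ : ℝ, 0 < cδ ∧ ∀ ζ : E, ‖ζ‖ = 1 → ∀ g : H, cδ < V (Lθ ζ - Lh g)

/-- The condition on the model on `N`. Here `F` is `η` viewed as a map into `L²₀(ν.tilted (η τ₀))`.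
The densities exist, `F` is one-to-one and three times continuously Fréchet differentiable on `N`,
and `τ₀` is the unique root in `N` of the expected score equations. Since
`D 𝔏ₙ(τ) v = -n⁻¹ ∑ D F(τ) v (Xᵢ) + μ_τ[D F(τ) v]` with `Xᵢ` distributed as `ν.tilted (η τ₀)`, the
expected score in the direction `v` is `μ_τ[D F(τ) v] - μ_{τ₀}[D F(τ) v]`. -/
structure ModelCondition {E H 𝒳 : Type*} [NormedAddCommGroup E] [NormedSpace ℝ E]
    [NormedAddCommGroup H] [NormedSpace ℝ H] [MeasurableSpace 𝒳] (ν : Measure 𝒳)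
    (η : E × H → 𝒳 → ℝ) (τ₀ : E × H) (F : E × H → L20 (ν.tilted (η τ₀))) (N : Set (E × H)) :
    Prop where
  integrable_exp : ∀ τ ∈ N, Integrable (fun x => Real.exp (η τ x)) ν
  injOn : Set.InjOn F N
  contDiffOn : ContDiffOn ℝ 3 F N
  unique_root : ∀ τ ∈ N,
    ((∀ ζ : E, ∫ x, L20fn (Dθ F τ ζ) x ∂(ν.tilted (η τ))
        - ∫ x, L20fn (Dθ F τ ζ) x ∂(ν.tilted (η τ₀)) = 0) ∧
      (∀ g : H, ∫ x, L20fn (Dh F τ g) x ∂(ν.tilted (η τ))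
        - ∫ x, L20fn (Dh F τ g) x ∂(ν.tilted (η τ₀)) = 0)) ↔ τ = τ₀

/-- Comparison on `N` of the derivative of `F` with the auxiliary operators. -/
def DerivComparison {E H 𝒳 : Type*} [NormedAddCommGroup E] [NormedSpace ℝ E]
    [NormedAddCommGroup H] [NormedSpace ℝ H] [MeasurableSpace 𝒳] {μ : Measure 𝒳}
    [IsFiniteMeasure μ] (F : E × H → L20 μ) (N : Set (E × H)) (Lθ : E →L[ℝ] L20 μ)
    (Lh : H →L[ℝ] L20 μ) (C₁ C₂ : ℝ) : Prop :=
  ∀ τ ∈ N, ∀ (ζ : E) (g : H),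
    C₁ * V (Lθ ζ + Lh g) ≤ V (Dθ F τ ζ + Dh F τ g) ∧
      V (Dθ F τ ζ + Dh F τ g) ≤ C₂ * V (Lθ ζ + Lh g)

/-- Bound, with a constant smaller than `2 C₁`, on the variation over `N` of the derivative
of `F`. -/
def DerivVariation {E H 𝒳 : Type*} [NormedAddCommGroup E] [NormedSpace ℝ E]
    [NormedAddCommGroup H] [NormedSpace ℝ H] [MeasurableSpace 𝒳] {μ : Measure 𝒳}
    [IsFiniteMeasure μ] (F : E × H → L20 μ) (N : Set (E × H)) (Lθ : E →L[ℝ] L20 μ)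
    (Lh : H →L[ℝ] L20 μ) (C₁ : ℝ) : Prop :=
  ∀ τ₁ ∈ N, ∀ τ₂ ∈ N, ∃ Cd : ℝ, 0 < Cd ∧ Cd < 2 * C₁ ∧ ∀ (ζ : E) (g : H), (ζ, g) ∈ N →
    V ((Dθ F τ₁ - Dθ F τ₂) ζ + (Dh F τ₁ - Dh F τ₂) g) ≤ Cd * V (Lθ ζ + Lh g)

/-- The variances `V_τ`, `τ ∈ N`, are uniformly equivalent to `V_{τ₀}` on `L²₀`. -/
def VarianceComparison {E H 𝒳 : Type*} [MeasurableSpace 𝒳] (ν : Measure 𝒳)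
    (η : E × H → 𝒳 → ℝ) (τ₀ : E × H) (N : Set (E × H)) : Prop :=
  ∃ C₃ C₄ : ℝ, 0 < C₃ ∧ 0 < C₄ ∧ ∀ τ ∈ N, ∀ f : L20 (ν.tilted (η τ₀)),
    MemLp (L20fn f) 2 (ν.tilted (η τ)) ∧
      C₃ * V f ≤ Var[L20fn f; ν.tilted (η τ)] ∧ Var[L20fn f; ν.tilted (η τ)] ≤ C₄ * V f

/-- The quadratic functional `B` is completely continuous with respect to the quadratic
functional `A`: for every `ε > 0` there are finitely many linear functionals such that
`B(g) ≤ ε A(g)` whenever they all vanish at `g`. -/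
def CompletelyContinuous {H : Type*} [NormedAddCommGroup H] [NormedSpace ℝ H] (B A : H → ℝ) :
    Prop :=
  ∀ ε : ℝ, 0 < ε → ∃ (k : ℕ) (l : Fin k → (H →L[ℝ] ℝ)), ∀ g : H, (∀ j, l j g = 0) → B g ≤ ε * A g

/-- `φ 0, φ 1, …` and `ρ 0, ρ 1, …` are a (complete) system of eigenfunctions and the corresponding
eigenvalues for the functionals `g ↦ V(Lh g)` and `J`. -/
structure IsEigensystem {H 𝒳 : Type*} [NormedAddCommGroup H] [NormedSpace ℝ H]
    [MeasurableSpace 𝒳] {μ : Measure 𝒳} [IsFiniteMeasure μ] (J : LinearMap.BilinForm ℝ H)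
    (Lh : H →L[ℝ] L20 μ) (φ : ℕ → H) (ρ : ℕ → ℝ) : Prop where
  orthonormal : ∀ i j, Vcov (Lh (φ i)) (Lh (φ j)) = if i = j then 1 else 0
  diagonal : ∀ i j, J (φ i) (φ j) = if i = j then ρ i else 0
  complete : (Submodule.span ℝ (Set.range φ)).topologicalClosure = ⊤

/-- The eigenvalues, numbered from one, are of the exact order `ν ^ r`. -/
def EigenvalueGrowth (ρ : ℕ → ℝ) (r : ℝ) : Prop :=
  ∃ (β₁ β₂ : ℝ) (κ : ℕ → ℝ), 0 < β₁ ∧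
    ∀ᶠ i in atTop, κ i ∈ Set.Ioo β₁ β₂ ∧ ρ i = κ i * ((i : ℝ) + 1) ^ r

/-! ### Norm and stochastic order -/

/-- `‖g‖_H = (V(Lh g) + lam J(g))^{1/2}`. -/
def normH {H 𝒳 : Type*} [NormedAddCommGroup H] [NormedSpace ℝ H] [MeasurableSpace 𝒳]
    {μ : Measure 𝒳} [IsFiniteMeasure μ] (J : LinearMap.BilinForm ℝ H) (Lh : H →L[ℝ] L20 μ)
    (lam : ℝ) (g : H) : ℝ :=
  √(V (Lh g) + lam * J g g)

/-- `Yₙ = O_p(aₙ)`. -/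
def IsBigOp {Ω : Type*} [MeasurableSpace Ω] (P : Measure Ω) (Y : ℕ → Ω → ℝ) (a : ℕ → ℝ) : Prop :=
  ∀ ε : ℝ, 0 < ε → ∃ M : ℝ, 0 < M ∧
    ∀ᶠ n in atTop, P {ω | M * a n < |Y n ω|} ≤ ENNReal.ofReal ε

end

end SemiparDensity

/-! Additivity makes the map `F` from the parameter to `L20` affine in `h`, so its partial
derivative in `h` is the same at every point of `N` and equals the inclusion `ι`. Boundedness of `ι`
is thus free, and the derivative comparison at `τ₀` says that the pair (`Dθ F τ₀`, `ι`) is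
equivalent to (`Lθ`, `Lh`). Every admissibility condition transfers along this equivalence.

For the rate, write `D = Dθ F τ₀` and measure increments v = (ζ, g) by p(v)² = ‖D ζ + ι g‖² + λ J(g,
g). The log likelihood increment is K - q, where K is the Kullback–Leibler divergence from the truth
and q an empirical mean. Comparison of variances on all of `L20` forces |η(τ) - η(τ₀)| to be
essentially bounded, uniformly over `N` (`exists_ae_abs_le_of_variance_comparison`). Hence K
dominates ‖F τ - F τ₀‖², which near θ₀ dominates ‖D ζ + ι g‖² (`exists_local_bounds`). By convexity,
an estimator outside the p-sphere of radius d would give a point on the sphere where the penalized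
likelihood is at most its value at `τ₀` (`IsEstimator.sqrt_le`). It remains to show that on the
sphere, with d a large multiple of the rate, q and the cross term λ J(h₀, g) are smaller than c d².

By additivity q splits into two parts. In g it is a continuous linear functional, since evaluations
on the kernel space are continuous. Its squared dual norm in the eigensystem has expectation of
order n⁻¹ ∑ 1/(1 + λ ρᵢ), that is n⁻¹ λ^(-1/r) (`tsum_inv_one_add_le`). In ζ it is nonlinear, and
smoothness is known only in L², which gives no uniform control of sample values. Here convexity of
the likelihood replaces pointwise smoothness: K - q is convex and K has a small Lipschitz constant,
so finitely many test points, each handled by Chebyshev, control q on a ball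
(`exists_finset_control_of_convexOn`). -/

namespace SemiparDensity

/-! ### Elementary bounds for the exponential. -/

/-- The 1/4 comes from the middle range -2 ≤ u ≤ 0, where exp u = (exp (u/2))² ≥ (1 + u/2)². Below
-2 the right side is at least 1 while exp(-M) u² ≤ exp(u) u² ≤ 2. -/
theorem sq_le_exp_sub_one_sub {M u : ℝ} (hu : |u| ≤ M) :
    Real.exp (-M) / 4 * u ^ 2 ≤ Real.exp u - 1 - u := by
  obtain ⟨h1, h2⟩ := abs_le.1 hu
  have hM : Real.exp (-M) ≤ 1 := by rw [Real.exp_le_one_iff]; linarith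
  have hpos := Real.exp_pos (-M)
  rcases le_total 0 u with h | h
  · have := Real.quadratic_le_exp_of_nonneg h
    nlinarith [sq_nonneg u]
  rcases le_total (-2) u with h3 | h3
  · have h4 : 1 + u / 2 ≤ Real.exp (u / 2) := by linarith [Real.add_one_le_exp (u / 2)]
    have h5 : Real.exp u = Real.exp (u / 2) ^ 2 := by rw [← Real.exp_nat_mul]; congr 1; push_cast; ring
    have h6 : (1 + u / 2) ^ 2 ≤ Real.exp (u / 2) ^ 2 := pow_le_pow_left₀ (by linarith) h4 2
    nlinarith [sq_nonneg u]
  · have h4 := Real.quadratic_le_exp_of_nonneg (x := -u) (by linarith)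
    have h5 : Real.exp (-M) ≤ Real.exp u := Real.exp_le_exp.2 h1
    have h6 : Real.exp u * Real.exp (-u) = 1 := by rw [← Real.exp_add]; simp
    have h7 := Real.exp_pos u
    have h8 : Real.exp u * u ^ 2 ≤ 2 := by nlinarith
    nlinarith [sq_nonneg u]

/-- Convexity places exp a - exp b between exp b (a - b) and exp a (a - b), and |exp c - 1| ≤ exp M
|c|. The factor |u| + |v| is what makes the divergence flat near the truth. -/
theorem abs_exp_sub_exp_sub_le {M u v : ℝ} (hu : |u| ≤ M) (hv : |v| ≤ M) :
    |(Real.exp u - Real.exp v) - (u - v)| ≤ Real.exp M * (|u - v| * (|u| + |v|)) := by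
  have key : ∀ a b : ℝ, |a| ≤ M → |b| ≤ M → b ≤ a →
      |(Real.exp a - Real.exp b) - (a - b)| ≤ Real.exp M * (|a - b| * (|a| + |b|)) := by
    intro a b ha hb hab
    obtain ⟨a1, a2⟩ := abs_le.1 ha
    have hM0 : 0 ≤ M := (abs_nonneg a).trans ha
    have hexp : 1 ≤ Real.exp M := Real.one_le_exp hM0
    -- `exp a - exp b ≤ exp a (a - b)` and `exp a - exp b ≥ exp b (a - b)`
    have e1 : Real.exp b * (a - b) ≤ Real.exp a - Real.exp b := by
      have := Real.add_one_le_exp (a - b)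
      have h := Real.exp_pos b
      have h' : Real.exp a = Real.exp b * Real.exp (a - b) := by rw [← Real.exp_add]; ring_nf
      rw [h']; nlinarith
    have e2 : Real.exp a - Real.exp b ≤ Real.exp a * (a - b) := by
      have := Real.add_one_le_exp (b - a)
      have h := Real.exp_pos a
      have h' : Real.exp b = Real.exp a * Real.exp (b - a) := by rw [← Real.exp_add]; ring_nf
      rw [h']; nlinarith
    have f : ∀ c : ℝ, |c| ≤ M → |Real.exp c - 1| ≤ Real.exp M * |c| := by
      intro c hc
      obtain ⟨c1, c2⟩ := abs_le.1 hc
      have hcM : Real.exp c ≤ Real.exp M := Real.exp_le_exp.2 c2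
      have g1 := Real.add_one_le_exp c
      have g2 : Real.exp c - 1 ≤ Real.exp c * c := by
        have := Real.add_one_le_exp (-c)
        have h' : Real.exp c * Real.exp (-c) = 1 := by rw [← Real.exp_add]; simp
        nlinarith [Real.exp_pos c]
      rw [abs_le]
      constructor
      · nlinarith [neg_abs_le c, abs_nonneg c]
      · nlinarith [le_abs_self c, abs_nonneg c, Real.exp_pos c]
    have fa := abs_le.1 (f a ha)
    have fb := abs_le.1 (f b hb)
    rw [abs_of_nonneg (sub_nonneg.2 hab)]
    have hab' := sub_nonneg.2 hab
    have p1 : 0 ≤ Real.exp M * |a| := by positivity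
    have p2 : 0 ≤ Real.exp M * |b| := by positivity
    rw [abs_le]
    constructor <;> nlinarith
  rcases le_total v u with h | h
  · exact key u v hu hv h
  · have := key v u hv hu h
    rw [← abs_neg, abs_sub_comm u v, add_comm |u|]
    convert this using 2
    ring

/-! ### Convex functions controlled by finitely many points. -/

open scoped Pointwise in
/-- A finite set of test points controls a function `q` on the unit ball if `k - q` is convex and
`k` is Lipschitz with a small constant. -/
theorem exists_finset_control_of_convexOn (E : Type*) [NormedAddCommGroup E] [NormedSpace ℝ E]
    [FiniteDimensional ℝ E] :
    ∃ R : ℝ, 1 ≤ R ∧ ∃ C : ℝ, 0 < C ∧ ∀ s : ℝ, 0 < s → s ≤ 1 → ∃ T : Finset E,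
      (∀ v ∈ T, ‖v‖ ≤ R) ∧ ∀ (q k : E → ℝ) (B Q : ℝ), 0 ≤ B → 0 ≤ Q →
        ConvexOn ℝ (Metric.closedBall 0 R) (fun x => k x - q x) → q 0 = 0 → k 0 = 0 →
        (∀ x ∈ Metric.closedBall (0 : E) R, ∀ y ∈ Metric.closedBall (0 : E) R,
          |k x - k y| ≤ B * ‖x - y‖) →
        (∀ v ∈ T, |q v| ≤ Q) → ∀ x : E, ‖x‖ ≤ 1 → |q x| ≤ C * (Q + s * B) := by
  classical
  -- A simplex around 0, scaled by `c` so that its hull contains the ball of radius 3. Its vertices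
  -- bound a convex function from above on that ball.
  obtain ⟨b, hb, hbs⟩ := exists_mem_interior_convexHull_affineBasis
    (Metric.closedBall_mem_nhds (0 : E) one_pos)
  obtain ⟨ρ, hρ, hball⟩ := Metric.mem_nhds_iff.1 (mem_interior_iff_mem_nhds.1 hb)
  set c : ℝ := 3 / ρ with hc
  have hc0 : 0 < c := by positivity
  set R : ℝ := max c 3 with hR
  have hR3 : 3 ≤ R := le_max_right _ _
  have hcR : c ≤ R := le_max_left _ _
  let T₀ : Finset E := Finset.univ.image (fun i => c • b i)
  have hT₀ : ∀ v ∈ T₀, ‖v‖ ≤ R := by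
    intro v hv
    obtain ⟨i, -, rfl⟩ := Finset.mem_image.1 hv
    have : b i ∈ Metric.closedBall (0 : E) 1 := hbs (subset_convexHull ℝ _ ⟨i, rfl⟩)
    rw [mem_closedBall_zero_iff] at this
    rw [norm_smul, Real.norm_of_nonneg hc0.le]
    nlinarith
  have hT₀hull : Metric.ball (0 : E) 3 ⊆ convexHull ℝ (T₀ : Set E) := by
    intro x hx
    have hx' : c⁻¹ • x ∈ Metric.ball (0 : E) ρ := by
      rw [mem_ball_zero_iff] at hx ⊢
      rw [norm_smul, norm_inv, Real.norm_of_nonneg hc0.le, hc, inv_div]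
      rw [div_mul_eq_mul_div, div_lt_iff₀ (by norm_num)]
      nlinarith
    have h1 : c⁻¹ • x ∈ convexHull ℝ (Set.range b) := hball hx'
    have h2 : (T₀ : Set E) = c • Set.range b := by
      ext y; simp [T₀, Set.mem_smul_set]
    rw [h2, convexHull_smul]
    exact ⟨_, h1, by simp [smul_smul, hc0.ne']⟩
  refine ⟨R, by linarith, 4 * R + 5, by linarith, fun s hs hs1 => ?_⟩
  obtain ⟨t, htf, ht⟩ := Metric.totallyBounded_iff.1
    (isCompact_closedBall (0 : E) 1).totallyBounded s hs
  -- Net centres may lie far from the unit ball, but any centre within s ≤ 1 of it has norm below 2,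
  -- so the filter loses nothing needed.
  let T₁ : Finset E := htf.toFinset.filter (fun v => ‖v‖ ≤ 1 + 1)
  refine ⟨T₀ ∪ T₁, ?_, ?_⟩
  · intro v hv
    rcases Finset.mem_union.1 hv with h | h
    · exact hT₀ v h
    · have := (Finset.mem_filter.1 h).2
      linarith
  intro q k B Q hB hQ hconv hq0 hk0 hk hqT x hx
  set Z : E → ℝ := fun x => k x - q x with hZ
  have hkR : ∀ y : E, ‖y‖ ≤ R → |k y| ≤ B * R := by
    intro y hy
    have := hk y (by simpa using hy) 0 (by simp; linarith)
    rw [hk0] at this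
    simp only [sub_zero] at this
    exact this.trans (by gcongr)
  set m : ℝ := Q + B * R with hm
  have hsub : Metric.ball (0 : E) 3 ⊆ Metric.closedBall 0 R := fun y hy => by
    rw [mem_ball_zero_iff] at hy; simp; linarith
  have hup : ∀ y ∈ Metric.ball (0 : E) 3, Z y ≤ m := by
    intro y hy
    obtain ⟨v, hv, hyv⟩ := hconv.exists_ge_of_mem_convexHull
      (t := (T₀ : Set E)) (fun v hv => by simpa using hT₀ v hv) (hT₀hull hy)
    refine hyv.trans ?_
    have h1 := hqT v (Finset.mem_union_left _ hv)
    have h2 := hkR v (hT₀ v hv)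
    have := (abs_le.1 h1).1
    have := (abs_le.1 h2).2
    simp only [hm]; linarith
  have hZ0 : Z 0 = 0 := by simp [hZ, hq0, hk0]
  -- Reflection through 0, where Z vanishes, turns the upper bound into a lower one.
  have habs : ∀ y ∈ Metric.ball (0 : E) 3, |Z y| ≤ m := by
    intro y hy
    refine abs_le.2 ⟨?_, hup y hy⟩
    have hy' : -y ∈ Metric.ball (0 : E) 3 := by simpa using hy
    have h1 := hconv.2 (hsub hy) (hsub hy') (by norm_num : (0 : ℝ) ≤ 1 / 2)
      (by norm_num : (0 : ℝ) ≤ 1 / 2) (by norm_num)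
    have h2 : (1 / 2 : ℝ) • y + (1 / 2 : ℝ) • (-y) = 0 := by simp
    rw [h2] at h1
    change Z 0 ≤ (1 / 2 : ℝ) * Z y + (1 / 2 : ℝ) * Z (-y) at h1
    rw [hZ0] at h1
    have := hup _ hy'
    linarith
  -- A convex function bounded by m on radius 3 is 2m-Lipschitz on radius 2, which carries the net
  -- values over to the unit ball.
  have hlip := (hconv.subset hsub (convex_ball _ _)).lipschitzOnWith_of_abs_le (ε := 1) one_pos
    (M := m) (fun a ha => habs a (by simpa using ha))
  obtain ⟨v, hvt, hxv⟩ := Set.mem_iUnion₂.1 (ht (by simpa using hx : x ∈ Metric.closedBall 0 1))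
  rw [Metric.mem_ball, dist_eq_norm] at hxv
  have hm0 : 0 ≤ m := by positivity
  have hv2 : ‖v‖ < 2 := by
    have h1 : ‖v‖ ≤ ‖x‖ + ‖x - v‖ := by
      have := norm_sub_le x (x - v)
      simpa using this
    linarith
  have hvT : |q v| ≤ Q := hqT v (Finset.mem_union_right _ (by simp [T₁, hvt]; linarith))
  have h1 := hlip.dist_le_mul x (by simp; linarith) v (by simp; linarith)
  rw [Real.dist_eq, dist_eq_norm, Real.coe_toNNReal _ (by positivity)] at h1
  have h2 := hk x (by simp; linarith) v (by simp; linarith)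
  have h3 : q x = (q v + (k x - k v)) - (Z x - Z v) := by simp [hZ]; ring
  have h4 : |q x| ≤ |q v| + |k x - k v| + |Z x - Z v| := by
    rw [h3]; exact (abs_sub _ _).trans (by gcongr; exact abs_add_le _ _)
  have h5 : |Z x - Z v| ≤ 2 * m * s := h1.trans (by
    have : 2 * m / 1 * ‖x - v‖ ≤ 2 * m / 1 * s := by gcongr
    simpa using this)
  have h6 : |k x - k v| ≤ B * s := h2.trans (by gcongr)
  have hBs : 0 ≤ B * s := by positivity
  have hQs : Q * s ≤ Q := mul_le_of_le_one_right hQ hs1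
  calc |q x| ≤ Q + B * s + 2 * m * s := by linarith
    _ = Q + 2 * (Q * s) + (1 + 2 * R) * (B * s) := by rw [hm]; ring
    _ ≤ (4 * R + 5) * (Q + s * B) := by nlinarith

/-! ### The effective dimension of the penalized eigensystem. -/

/-- Cut the indices into blocks of length m = ⌈λ^(-1/r)⌉. In block j, beyond the first i₀ indices, λ
ρᵢ ≥ β₁ j^r, so the sum is at most i₀ + m ∑ⱼ 1/(1 + β₁ j^r), a convergent series because r > 1. For
λ ≤ 1 the terms i₀ and the rounding are absorbed. -/
theorem tsum_inv_one_add_le {ρ : ℕ → ℝ} {r : ℝ} (hρ0 : ∀ i, 0 ≤ ρ i) (hr : 1 < r)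
    (hρ : EigenvalueGrowth ρ r) :
    ∃ C : ℝ, 0 < C ∧ ∀ lam : ℝ, 0 < lam → lam ≤ 1 →
      ∑' i, ENNReal.ofReal (1 / (1 + lam * ρ i)) ≤ ENNReal.ofReal (C * lam ^ (-(1 / r))) := by
  obtain ⟨β₁, β₂, κ, hβ, hκ⟩ := hρ
  obtain ⟨i₀, hi₀⟩ := eventually_atTop.1 hκ
  have hr0 : 0 < r := by linarith
  set a : ℕ → ℝ := fun j => 1 / (1 + β₁ * (j : ℝ) ^ r) with ha
  have ha0 : ∀ j, 0 ≤ a j := fun j => by simp only [ha]; positivity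
  have hsum : Summable a := by
    refine Summable.of_norm_bounded_eventually_nat (g := fun j : ℕ => β₁⁻¹ * (1 / (j : ℝ) ^ r))
      ((Real.summable_one_div_nat_rpow.2 hr).mul_left _) ?_
    filter_upwards [eventually_ge_atTop 1] with j hj
    have : (0 : ℝ) < (j : ℝ) ^ r := Real.rpow_pos_of_pos (by exact_mod_cast hj) _
    rw [Real.norm_of_nonneg (ha0 j), ← one_div, one_div_mul_one_div]
    apply one_div_le_one_div_of_le (by positivity); linarith
  have hS : 0 ≤ ∑' j, a j := tsum_nonneg ha0
  refine ⟨i₀ + 2 * ∑' j, a j + 1, by positivity, fun lam hl hl1 => ?_⟩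
  have hlr : 1 ≤ lam ^ (-(1 / r)) :=
    Real.one_le_rpow_of_pos_of_le_one_of_nonpos hl hl1 (by simp; positivity)
  set m : ℕ := ⌈lam ^ (-(1 / r))⌉₊ with hm
  have hm1 : lam ^ (-(1 / r)) ≤ m := Nat.le_ceil _
  have hm0 : 0 < m := Nat.ceil_pos.2 (by linarith)
  have hm2 : (m : ℝ) ≤ 2 * lam ^ (-(1 / r)) := by
    have := (Nat.ceil_lt_add_one (a := lam ^ (-(1 / r))) (by linarith)).le
    linarith
  have hlam : (1 / (m : ℝ)) ^ r ≤ lam := by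
    have h1 : 1 / (m : ℝ) ≤ lam ^ (1 / r) := by
      rw [Real.rpow_neg hl.le] at hm1
      rw [div_le_iff₀ (by exact_mod_cast hm0)]
      have := Real.rpow_pos_of_pos hl (1 / r)
      rw [inv_le_iff_one_le_mul₀ this] at hm1
      linarith
    calc (1 / (m : ℝ)) ^ r ≤ (lam ^ (1 / r)) ^ r :=
          Real.rpow_le_rpow (by positivity) h1 hr0.le
      _ = lam := by rw [← Real.rpow_mul hl.le]; field_simp; simp
  have hterm : ∀ i, ENNReal.ofReal (1 / (1 + lam * ρ i)) ≤
      (if i ∈ Finset.range i₀ then 1 else 0) + ENNReal.ofReal (a (i / m)) := by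
    intro i
    by_cases hi : i < i₀
    · simp only [Finset.mem_range, hi, if_true]
      refine le_add_right ?_
      rw [← ENNReal.ofReal_one]
      apply ENNReal.ofReal_le_ofReal
      rw [div_le_one (by have := hρ0 i; positivity)]
      have := mul_nonneg hl.le (hρ0 i); linarith
    · simp only [Finset.mem_range, hi, if_false, zero_add]
      apply ENNReal.ofReal_le_ofReal
      apply one_div_le_one_div_of_le (by positivity)
      obtain ⟨hk1, hk2⟩ := hi₀ i (not_lt.1 hi)
      have h1 : ((i / m : ℕ) : ℝ) ≤ (1 / (m : ℝ)) * ((i : ℝ) + 1) := by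
        have := Nat.cast_div_le (α := ℝ) (m := i) (n := m)
        have h3 : (i : ℝ) / m ≤ 1 / (m : ℝ) * ((i : ℝ) + 1) := by
          rw [div_mul_eq_mul_div, one_mul]; gcongr; linarith
        exact this.trans h3
      have h2 : ((i / m : ℕ) : ℝ) ^ r ≤ lam * ((i : ℝ) + 1) ^ r := by
        calc ((i / m : ℕ) : ℝ) ^ r ≤ ((1 / (m : ℝ)) * ((i : ℝ) + 1)) ^ r :=
              Real.rpow_le_rpow (by positivity) h1 hr0.le
          _ = (1 / (m : ℝ)) ^ r * ((i : ℝ) + 1) ^ r := Real.mul_rpow (by positivity) (by positivity)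
          _ ≤ _ := by gcongr
      have h3 : β₁ * ((i : ℝ) + 1) ^ r ≤ ρ i := by rw [hk2]; gcongr; exact hk1.1.le
      have : β₁ * ((i / m : ℕ) : ℝ) ^ r ≤ lam * ρ i := by
        calc _ ≤ β₁ * (lam * ((i : ℝ) + 1) ^ r) := by gcongr
          _ = lam * (β₁ * ((i : ℝ) + 1) ^ r) := by ring
          _ ≤ _ := by gcongr
      linarith
  have : NeZero m := ⟨hm0.ne'⟩
  have hdiv : ∑' i : ℕ, ENNReal.ofReal (a (i / m)) = m * ENNReal.ofReal (∑' j, a j) := by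
    rw [← (Nat.divModEquiv m).symm.tsum_eq, ENNReal.tsum_prod']
    have : ∀ (j : ℕ) (k : Fin m),
        ENNReal.ofReal (a (((Nat.divModEquiv m).symm (j, k)) / m)) = ENNReal.ofReal (a j) := by
      intro j k
      congr 2
      change (j * m + k) / m = j
      rw [mul_comm, Nat.mul_add_div hm0, Nat.div_eq_of_lt k.2, add_zero]
    simp_rw [this]
    rw [ENNReal.ofReal_tsum_of_nonneg ha0 hsum, ← ENNReal.tsum_mul_left]
    simp
  have hfin : ∑' i : ℕ, (if i ∈ Finset.range i₀ then (1 : ENNReal) else 0) = i₀ := by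
    rw [tsum_eq_sum (s := Finset.range i₀) (fun b hb => by simp [hb])]
    rw [Finset.sum_ite_mem]; simp
  calc _ ≤ ∑' i : ℕ, ((if i ∈ Finset.range i₀ then (1 : ENNReal) else 0) +
        ENNReal.ofReal (a (i / m))) := ENNReal.tsum_le_tsum hterm
    _ = i₀ + m * ENNReal.ofReal (∑' j, a j) := by rw [ENNReal.tsum_add, hfin, hdiv]
    _ = ENNReal.ofReal (i₀ + m * ∑' j, a j) := by
        rw [ENNReal.ofReal_add (by positivity) (by positivity),
          ENNReal.ofReal_mul (by positivity), ENNReal.ofReal_natCast, ENNReal.ofReal_natCast]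
    _ ≤ _ := by
        apply ENNReal.ofReal_le_ofReal
        have h1 : (m : ℝ) * ∑' j, a j ≤ 2 * lam ^ (-(1 / r)) * ∑' j, a j := by gcongr
        have h2 : (i₀ : ℝ) ≤ i₀ * lam ^ (-(1 / r)) := le_mul_of_one_le_right (by positivity) hlr
        nlinarith

/-! ### The Hilbert space structure of centred functions. -/

theorem integral_abs_mul_abs_le {𝒳 : Type*} [MeasurableSpace 𝒳] {μ : Measure 𝒳} {f g : 𝒳 → ℝ} (hf : MemLp f 2 μ) (hg : MemLp g 2 μ) :
    ∫ x, |f x| * |g x| ∂μ ≤ √(∫ x, f x ^ 2 ∂μ) * √(∫ x, g x ^ 2 ∂μ) := by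
  have := integral_mul_norm_le_Lp_mul_Lq (μ := μ) (f := f) (g := g) (p := 2) (q := 2)
    Real.HolderConjugate.two_two (by simpa using hf) (by simpa using hg)
  simpa [Real.sqrt_eq_rpow] using this

theorem variance_indicator_one {𝒳 : Type*} [MeasurableSpace 𝒳] {Q : Measure 𝒳} [IsProbabilityMeasure Q] {B : Set 𝒳}
    (hB : MeasurableSet B) :
    Var[B.indicator (fun _ => (1 : ℝ)); Q] = Q.real B * (1 - Q.real B) := by
  have hm : MemLp (B.indicator (fun _ => (1 : ℝ))) 2 Q := memLp_indicator_const _ hB _ (by simp)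
  have h2 : (B.indicator (fun _ => (1 : ℝ))) ^ 2 = B.indicator (fun _ => (1 : ℝ)) := by
    ext x; by_cases hx : x ∈ B <;> simp [hx]
  rw [variance_eq_sub hm, h2, integral_indicator_const _ hB]
  simp; ring

section L20

variable {𝒳 : Type*} [MeasurableSpace 𝒳] {μ : Measure 𝒳} [IsFiniteMeasure μ]

theorem memL20_L20fn (f : L20 μ) : MemL20 μ (L20fn f) := ⟨Lp.memLp _, f.2⟩

theorem L20fn_toL20 {f : 𝒳 → ℝ} (hf : MemL20 μ f) : L20fn hf.toL20 =ᵐ[μ] f := hf.1.coeFn_toLp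

theorem V_eq_integral (f : L20 μ) : V f = ∫ x, L20fn f x ^ 2 ∂μ :=
  variance_of_integral_eq_zero (memL20_L20fn f).1.aestronglyMeasurable.aemeasurable f.2

theorem V_eq_norm_sq (f : L20 μ) : V f = ‖f‖ ^ 2 := by
  rw [V_eq_integral]
  change _ = ‖(f : Lp ℝ 2 μ)‖ ^ 2
  rw [← real_inner_self_eq_norm_sq, L2.inner_def]
  refine integral_congr_ae (ae_of_all _ fun x => ?_)
  simp [L20fn]

theorem norm_toL20 {f : 𝒳 → ℝ} (hf : MemL20 μ f) : ‖hf.toL20‖ = √(∫ x, f x ^ 2 ∂μ) := by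
  rw [eq_comm, Real.sqrt_eq_iff_mul_self_eq (integral_nonneg fun x => sq_nonneg _) (norm_nonneg _),
    ← sq, ← V_eq_norm_sq, V_eq_integral]
  refine integral_congr_ae ?_
  filter_upwards [L20fn_toL20 hf] with x hx
  rw [hx]

theorem L20_ext {f g : L20 μ} (h : L20fn f =ᵐ[μ] L20fn g) : f = g := Subtype.ext (Lp.ext h)

theorem MemL20.sub {f g : 𝒳 → ℝ} (hf : MemL20 μ f) (hg : MemL20 μ g) :
    MemL20 μ (fun x => f x - g x) := by
  refine ⟨hf.1.sub hg.1, ?_⟩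
  rw [integral_sub (hf.1.integrable (by norm_num)) (hg.1.integrable (by norm_num)), hf.2, hg.2,
    sub_zero]

theorem MemL20.toL20_sub {f g : 𝒳 → ℝ} (hf : MemL20 μ f) (hg : MemL20 μ g) :
    (hf.sub hg).toL20 = hf.toL20 - hg.toL20 := by
  apply Subtype.ext
  exact MemLp.toLp_sub hf.1 hg.1

end L20

/-! ### Bounded log density ratios and the Kullback–Leibler divergence. -/

section Tilted

variable {𝒳 : Type*} [MeasurableSpace 𝒳] {μ : Measure 𝒳} [IsProbabilityMeasure μ]

/-- Equivalence of the variances on all of `L²₀` forces the density of the tilted measure to be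
bounded away from zero and infinity, uniformly in the tilt. -/
theorem exists_ae_abs_le_of_variance_comparison {B₀ : Set 𝒳} (hB₀ : MeasurableSet B₀)
    (h0 : μ B₀ ≠ 0) (h1 : μ B₀ᶜ ≠ 0) {C₃ C₄ : ℝ} (hC₃ : 0 < C₃) (hC₄ : 0 < C₄) :
    ∃ M : ℝ, ∀ u : 𝒳 → ℝ, MemL20 μ u → Integrable (fun x => Real.exp (u x)) μ →
      (∀ f : L20 μ, C₃ * V f ≤ Var[L20fn f; μ.tilted u] ∧ Var[L20fn f; μ.tilted u] ≤ C₄ * V f) →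
      ∀ᵐ x ∂μ, |u x| ≤ M := by
  set b := μ.real B₀ with hb
  have hb0 : 0 < b := by
    rw [hb, measureReal_def]; exact ENNReal.toReal_pos h0 (measure_ne_top _ _)
  have hbc : μ.real B₀ᶜ = 1 - b := by rw [probReal_compl_eq_one_sub hB₀]
  have hb1 : 0 < 1 - b := by
    rw [← hbc, measureReal_def]; exact ENNReal.toReal_pos h1 (measure_ne_top _ _)
  set d := min b (1 - b) with hd
  have hd0 : 0 < d := lt_min hb0 hb1
  set c := C₃ * d with hc
  have hc0 : 0 < c := by positivity
  set C := C₄ / (c * d) with hC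
  have hCpos : 0 < C := by positivity
  refine ⟨Real.log C - Real.log c, fun u hu hexp hvar => ?_⟩
  set Q := μ.tilted u with hQ
  have : IsProbabilityMeasure Q := isProbabilityMeasure_tilted hexp
  -- the comparison for indicators
  have hind : ∀ B, MeasurableSet B → C₃ * (μ.real B * (1 - μ.real B)) ≤ Q.real B * (1 - Q.real B) ∧
      Q.real B * (1 - Q.real B) ≤ C₄ * (μ.real B * (1 - μ.real B)) := by
    intro B hB
    have hm : MemLp (B.indicator (fun _ => (1 : ℝ))) 2 μ := memLp_indicator_const _ hB _ (by simp)
    have hf : MemL20 μ (fun x => B.indicator (fun _ => (1 : ℝ)) x - μ.real B) := by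
      refine ⟨hm.sub (memLp_const _), ?_⟩
      rw [integral_sub (hm.integrable (by norm_num)) (integrable_const _),
        integral_indicator_const _ hB]
      simp
    have hv := hvar hf.toL20
    have hsm : StronglyMeasurable (B.indicator (fun _ => (1 : ℝ))) :=
      stronglyMeasurable_const.indicator hB
    have e1 : V hf.toL20 = μ.real B * (1 - μ.real B) := by
      rw [V, variance_congr (L20fn_toL20 hf), variance_sub_const hsm.aestronglyMeasurable,
        variance_indicator_one hB]
    have e2 : Var[L20fn hf.toL20; Q] = Q.real B * (1 - Q.real B) := by
      rw [variance_congr ((tilted_absolutelyContinuous μ u).ae_eq (L20fn_toL20 hf)),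
        variance_sub_const hsm.aestronglyMeasurable, variance_indicator_one hB]
    rw [e1, e2] at hv
    exact hv
  -- The factor 1 - μ(B) is harmless as long as B lies in `B₀` or in its complement; a general set
  -- is split in two.
  have key : ∀ B, MeasurableSet B → ∀ D, MeasurableSet D → B ⊆ D → d ≤ 1 - μ.real D →
      c * μ.real B ≤ Q.real B := by
    intro B hB D hD hBD hdD
    have h := (hind B hB).1
    have h2 : μ.real B ≤ μ.real D := measureReal_mono hBD
    have h3 : 0 ≤ μ.real B := measureReal_nonneg
    have h4 : 0 ≤ Q.real B := measureReal_nonneg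
    calc c * μ.real B = C₃ * (μ.real B * d) := by rw [hc]; ring
      _ ≤ C₃ * (μ.real B * (1 - μ.real B)) := by gcongr; linarith
      _ ≤ Q.real B * (1 - Q.real B) := h
      _ ≤ Q.real B := by nlinarith
  have hd1 : d ≤ 1 - μ.real B₀ := min_le_right _ _
  have hd2 : d ≤ 1 - μ.real B₀ᶜ := by rw [hbc]; linarith [min_le_left b (1 - b)]
  have hsplit : ∀ (R : Measure 𝒳) [IsProbabilityMeasure R] (B : Set 𝒳),
      R.real B = R.real (B ∩ B₀) + R.real (B ∩ B₀ᶜ) := fun R _ B => by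
    rw [← Set.sdiff_eq, measureReal_inter_add_sdiff hB₀]
  have hlow : ∀ B, MeasurableSet B → c * μ.real B ≤ Q.real B := by
    intro B hB
    rw [hsplit μ B, hsplit Q B, mul_add]
    exact add_le_add (key _ (hB.inter hB₀) _ hB₀ Set.inter_subset_right hd1)
      (key _ (hB.inter hB₀.compl) _ hB₀.compl Set.inter_subset_right hd2)
  have key2 : ∀ B, MeasurableSet B → ∀ D, MeasurableSet D → B ⊆ D → d ≤ 1 - μ.real D →
      Q.real B ≤ C * μ.real B := by
    intro B hB D hD hBD hdD
    have h := (hind B hB).2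
    have h2 : Q.real B ≤ Q.real D := measureReal_mono hBD
    have h3 : 0 ≤ μ.real B := measureReal_nonneg
    have h4 : 0 ≤ Q.real B := measureReal_nonneg
    have h5 := hlow Dᶜ hD.compl
    rw [probReal_compl_eq_one_sub hD, probReal_compl_eq_one_sub hD] at h5
    -- The lower bound, applied to the complement of D, keeps Q(B) away from 1.
    have h6 : c * d ≤ 1 - Q.real B := by nlinarith
    rw [hC, div_mul_eq_mul_div, le_div_iff₀ (by positivity)]
    calc Q.real B * (c * d) ≤ Q.real B * (1 - Q.real B) := by gcongr
      _ ≤ C₄ * (μ.real B * (1 - μ.real B)) := h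
      _ ≤ C₄ * μ.real B := by gcongr; nlinarith
  have hupp : ∀ B, MeasurableSet B → Q.real B ≤ C * μ.real B := by
    intro B hB
    rw [hsplit μ B, hsplit Q B, mul_add]
    exact add_le_add (key2 _ (hB.inter hB₀) _ hB₀ Set.inter_subset_right hd1)
      (key2 _ (hB.inter hB₀.compl) _ hB₀.compl Set.inter_subset_right hd2)
  -- the density
  set Z := ∫ x, Real.exp (u x) ∂μ with hZ
  have hZ0 : 0 < Z := integral_exp_pos hexp
  have hmeas : AEMeasurable (fun x => ENNReal.ofReal (Real.exp (u x) / Z)) μ :=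
    (hexp.1.aemeasurable.div_const _).ennreal_ofReal
  have hQB : ∀ B, MeasurableSet B →
      ∫⁻ x in B, ENNReal.ofReal (Real.exp (u x) / Z) ∂μ = ENNReal.ofReal (Q.real B) := by
    intro B hB
    rw [hZ, ← tilted_apply' _ _ hB, ← hQ, measureReal_def, ENNReal.ofReal_toReal (by simp)]
  have hconst : ∀ (k : ℝ), 0 ≤ k → ∀ B, MeasurableSet B → ∫⁻ _ in B, ENNReal.ofReal k ∂μ =
      ENNReal.ofReal (k * μ.real B) := by
    intro k hk B hB
    rw [setLIntegral_const, ENNReal.ofReal_mul hk, measureReal_def,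
      ENNReal.ofReal_toReal (by simp)]
  have hl : (fun _ => ENNReal.ofReal c) ≤ᵐ[μ] fun x => ENNReal.ofReal (Real.exp (u x) / Z) := by
    refine ae_le_of_forall_setLIntegral_le_of_sigmaFinite₀ aemeasurable_const fun B hB _ => ?_
    rw [hQB B hB, hconst c hc0.le B hB]
    exact ENNReal.ofReal_le_ofReal (hlow B hB)
  have hr : (fun x => ENNReal.ofReal (Real.exp (u x) / Z)) ≤ᵐ[μ] fun _ => ENNReal.ofReal C := by
    refine ae_le_of_forall_setLIntegral_le_of_sigmaFinite₀ hmeas fun B hB _ => ?_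
    rw [hQB B hB, hconst C hCpos.le B hB]
    exact ENNReal.ofReal_le_ofReal (hupp B hB)
  have hl' : ∀ᵐ x ∂μ, Real.log c + Real.log Z ≤ u x := by
    filter_upwards [hl] with x hx
    rw [ENNReal.ofReal_le_ofReal_iff (by positivity), le_div_iff₀ hZ0] at hx
    rw [← Real.log_mul hc0.ne' hZ0.ne', Real.log_le_iff_le_exp (by positivity)]
    exact hx
  have hr' : ∀ᵐ x ∂μ, u x ≤ Real.log C + Real.log Z := by
    filter_upwards [hr] with x hx
    rw [ENNReal.ofReal_le_ofReal_iff (by positivity), div_le_iff₀ hZ0] at hx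
    rw [← Real.log_mul hCpos.ne' hZ0.ne', Real.le_log_iff_exp_le (by positivity)]
    exact hx
  have hui : Integrable u μ := hu.1.integrable (by norm_num)
  -- The density exp(u)/Z lies in [c, C]; since u has mean zero, this confines log Z to [-log C,
  -- -log c].
  have i1 : Real.log c + Real.log Z ≤ 0 := by
    have := integral_mono_ae (integrable_const _) hui hl'
    rw [hu.2] at this; simpa using this
  have i2 : 0 ≤ Real.log C + Real.log Z := by
    have := integral_mono_ae hui (integrable_const _) hr'
    rw [hu.2] at this; simpa using this
  filter_upwards [hl', hr'] with x h1 h2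
  rw [abs_le]; constructor <;> linarith

theorem integrable_exp_of_ae_abs_le {M : ℝ} {u : 𝒳 → ℝ} (hu : MemL20 μ u)
    (hM : ∀ᵐ x ∂μ, |u x| ≤ M) : Integrable (fun x => Real.exp (u x)) μ := by
  refine Integrable.of_bound (C := Real.exp M)
    (Real.continuous_exp.comp_aestronglyMeasurable hu.1.1) ?_
  filter_upwards [hM] with x hx
  rw [Real.norm_of_nonneg (Real.exp_pos _).le]
  exact Real.exp_le_exp.2 (abs_le.1 hx).2

theorem one_le_integral_exp {M : ℝ} {u : 𝒳 → ℝ} (hu : MemL20 μ u) (hM : ∀ᵐ x ∂μ, |u x| ≤ M) :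
    1 ≤ ∫ x, Real.exp (u x) ∂μ := by
  have hui : Integrable u μ := hu.1.integrable (by norm_num)
  have := integral_mono_ae (hui.add (integrable_const (1 : ℝ))) (integrable_exp_of_ae_abs_le hu hM)
    (ae_of_all _ fun x => Real.add_one_le_exp (u x))
  simp only [Pi.add_apply] at this
  rw [integral_add hui (integrable_const _), hu.2] at this
  simpa using this

/-- Quadratic lower bound for the Kullback–Leibler divergence. -/
theorem le_log_integral_exp {M : ℝ} {u : 𝒳 → ℝ} (hu : MemL20 μ u) (hM : ∀ᵐ x ∂μ, |u x| ≤ M) :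
    Real.exp (-M) ^ 2 / 4 * ∫ x, u x ^ 2 ∂μ ≤ Real.log (∫ x, Real.exp (u x) ∂μ) := by
  have hui : Integrable u μ := hu.1.integrable (by norm_num)
  have hei := integrable_exp_of_ae_abs_le hu hM
  set a := ∫ x, Real.exp (u x) ∂μ with ha
  have h1 : 1 ≤ a := one_le_integral_exp hu hM
  have hle : a ≤ Real.exp M := by
    have := integral_mono_ae hei (integrable_const (Real.exp M)) (by
      filter_upwards [hM] with x hx
      exact Real.exp_le_exp.2 (abs_le.1 hx).2)
    simpa using this
  have h2 : Real.exp (-M) / 4 * ∫ x, u x ^ 2 ∂μ ≤ a - 1 := by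
    have hei' : Integrable (fun x => Real.exp (u x) - 1) μ := hei.sub (integrable_const (1 : ℝ))
    have := integral_mono_ae (hu.1.integrable_sq.const_mul (Real.exp (-M) / 4))
      (hei'.sub hui) (by
        filter_upwards [hM] with x hx
        exact sq_le_exp_sub_one_sub hx)
    simp only [Pi.sub_apply] at this
    rw [integral_const_mul, integral_sub hei' hui,
      integral_sub hei (integrable_const (1 : ℝ)), hu.2] at this
    simpa using this
  -- The second factor exp(-M): log a ≥ (a - 1)/a and a ≤ exp M.
  have h3 : Real.exp (-M) * (a - 1) ≤ Real.log a := by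
    have h4 : 1 - a⁻¹ ≤ Real.log a := Real.one_sub_inv_le_log_of_pos (by linarith)
    have h5 : Real.exp (-M) ≤ a⁻¹ := by
      rw [Real.exp_neg]; exact inv_anti₀ (by linarith) hle
    have h6 : a⁻¹ * a = 1 := inv_mul_cancel₀ (by linarith)
    nlinarith
  calc _ = Real.exp (-M) * (Real.exp (-M) / 4 * ∫ x, u x ^ 2 ∂μ) := by ring
    _ ≤ Real.exp (-M) * (a - 1) := by gcongr
    _ ≤ _ := h3

/-- Since u and v are centred, the linear terms integrate to zero and the difference of the
exponential integrals is of second order. Both integrals are at least 1, where the logarithm is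
1-Lipschitz. -/
theorem abs_log_integral_exp_sub_le {M : ℝ} {u v : 𝒳 → ℝ} (hu : MemL20 μ u) (hv : MemL20 μ v)
    (hMu : ∀ᵐ x ∂μ, |u x| ≤ M) (hMv : ∀ᵐ x ∂μ, |v x| ≤ M) :
    |Real.log (∫ x, Real.exp (u x) ∂μ) - Real.log (∫ x, Real.exp (v x) ∂μ)| ≤
      Real.exp M * (√(∫ x, (u x - v x) ^ 2 ∂μ) * (√(∫ x, u x ^ 2 ∂μ) + √(∫ x, v x ^ 2 ∂μ))) := by
  have hui : Integrable u μ := hu.1.integrable (by norm_num)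
  have hvi : Integrable v μ := hv.1.integrable (by norm_num)
  have heu := integrable_exp_of_ae_abs_le hu hMu
  have hev := integrable_exp_of_ae_abs_le hv hMv
  set a := ∫ x, Real.exp (u x) ∂μ with ha
  set b := ∫ x, Real.exp (v x) ∂μ with hb
  have ha1 : 1 ≤ a := one_le_integral_exp hu hMu
  have hb1 : 1 ≤ b := one_le_integral_exp hv hMv
  have hab : |a - b| ≤ Real.exp M *
      (√(∫ x, (u x - v x) ^ 2 ∂μ) * (√(∫ x, u x ^ 2 ∂μ) + √(∫ x, v x ^ 2 ∂μ))) := by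
    have hee : Integrable (fun x => Real.exp (u x) - Real.exp (v x)) μ := heu.sub hev
    have huv : Integrable (fun x => u x - v x) μ := hui.sub hvi
    have e : a - b = ∫ x, ((Real.exp (u x) - Real.exp (v x)) - (u x - v x)) ∂μ := by
      rw [integral_sub hee huv, integral_sub heu hev, integral_sub hui hvi,
        hu.2, hv.2]
      simp [ha, hb]
    have hsub : MemLp (fun x => u x - v x) 2 μ := hu.1.sub hv.1
    have p1 : Integrable (fun x => |u x - v x| * |u x|) μ := hsub.abs.integrable_mul hu.1.abs
    have p2 : Integrable (fun x => |u x - v x| * |v x|) μ := hsub.abs.integrable_mul hv.1.abs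
    rw [e]
    calc _ ≤ ∫ x, |(Real.exp (u x) - Real.exp (v x)) - (u x - v x)| ∂μ := abs_integral_le_integral_abs
      _ ≤ ∫ x, Real.exp M * (|u x - v x| * |u x| + |u x - v x| * |v x|) ∂μ := by
          refine integral_mono_ae (hee.sub huv).abs
            ((p1.add p2).const_mul _) ?_
          filter_upwards [hMu, hMv] with x h1 h2
          have := abs_exp_sub_exp_sub_le h1 h2
          rw [mul_add] at this
          exact this
      _ = Real.exp M * (∫ x, |u x - v x| * |u x| ∂μ + ∫ x, |u x - v x| * |v x| ∂μ) := by
          rw [integral_const_mul, integral_add p1 p2]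
      _ ≤ _ := by
          rw [mul_add (√(∫ x, (u x - v x) ^ 2 ∂μ))]
          gcongr
          · exact integral_abs_mul_abs_le hsub hu.1
          · exact integral_abs_mul_abs_le hsub hv.1
  refine le_trans ?_ hab
  have hlog : ∀ s t : ℝ, 1 ≤ s → 1 ≤ t → Real.log s - Real.log t ≤ |s - t| := by
    intro s t hs ht
    rw [← Real.log_div (by linarith) (by linarith)]
    have h1 := Real.log_le_sub_one_of_pos (x := s / t) (by positivity)
    have h2 : s / t - 1 = (s - t) / t := by field_simp
    rw [h2] at h1
    refine h1.trans ((div_le_div_of_nonneg_right (le_abs_self _) (by linarith)).trans ?_)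
    exact div_le_self (abs_nonneg _) ht
  rw [abs_le]
  have := hlog a b ha1 hb1
  have h2 := hlog b a hb1 ha1
  rw [abs_sub_comm] at h2
  constructor <;> linarith

end Tilted

/-- The empirical mean of `f` over `x 0, …, x (n - 1)`. -/
noncomputable def empMean {𝒳 : Type*} (x : ℕ → 𝒳) (n : ℕ) (f : 𝒳 → ℝ) : ℝ :=
  (n : ℝ)⁻¹ * ∑ i ∈ Finset.range n, f (x i)

/-! ### Second moments of the empirical process. -/

section Empirical

variable {𝒳 Ω : Type*} [MeasurableSpace 𝒳] [MeasurableSpace Ω] {μ : Measure 𝒳}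
  {P : Measure Ω} {X : ℕ → Ω → 𝒳}

theorem memLp_comp_of_hasLaw {Y : Ω → 𝒳} (hY : HasLaw Y μ P) {f : 𝒳 → ℝ} (hf : MemLp f 2 μ) :
    MemLp (f ∘ Y) 2 P :=
  (memLp_map_measure_iff (by rw [hY.map_eq]; exact hf.1) hY.aemeasurable).1
    (by rw [hY.map_eq]; exact hf)

theorem memLp_empMean (hX : ∀ i, HasLaw (X i) μ P) {f : 𝒳 → ℝ} (hf : MemLp f 2 μ) (n : ℕ) :
    MemLp (fun ω => empMean (fun i => X i ω) n f) 2 P := by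
  have h : MemLp (fun ω => ∑ i ∈ Finset.range n, (f ∘ X i) ω) 2 P :=
    memLp_finsetSum (Finset.range n) fun i _ => memLp_comp_of_hasLaw (hX i) hf
  exact h.const_mul (n : ℝ)⁻¹

theorem integral_empMean_sq [IsProbabilityMeasure P] (hX : ∀ i, HasLaw (X i) μ P) (hindep : iIndepFun X P) {f : 𝒳 → ℝ}
    (hf : MemL20 μ f) (n : ℕ) :
    ∫ ω, empMean (fun i => X i ω) n f ^ 2 ∂P = (n : ℝ)⁻¹ * ∫ x, f x ^ 2 ∂μ := by
  have hm : ∀ i ∈ Finset.range n, MemLp (f ∘ X i) 2 P :=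
    fun i _ => memLp_comp_of_hasLaw (hX i) hf.1
  have hind : iIndepFun (fun i => f ∘ X i) P :=
    hindep.comp₀ (fun _ => f) (fun i => (hX i).aemeasurable)
      (fun i => by rw [(hX i).map_eq]; exact hf.1.1.aemeasurable)
  have hmean : ∀ i, P[f ∘ X i] = 0 := fun i => by rw [(hX i).integral_comp hf.1.1, hf.2]
  have hvar : ∀ i, Var[f ∘ X i; P] = ∫ x, f x ^ 2 ∂μ := fun i => by
    rw [variance_of_integral_eq_zero (memLp_comp_of_hasLaw (hX i) hf.1).1.aemeasurable (hmean i)]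
    exact (hX i).integral_comp (f := fun x => f x ^ 2) (hf.1.1.pow 2)
  have hsum : Var[∑ i ∈ Finset.range n, f ∘ X i; P] = n * ∫ x, f x ^ 2 ∂μ := by
    rw [IndepFun.variance_sum hm (fun i _ j _ hij => hind.indepFun hij)]
    simp [hvar]
  have hmsum : MemLp (∑ i ∈ Finset.range n, f ∘ X i) 2 P := memLp_finsetSum' _ hm
  have hzero : P[∑ i ∈ Finset.range n, f ∘ X i] = 0 := by
    simp only [Finset.sum_apply]
    rw [integral_finsetSum _ fun i hi => (hm i hi).integrable (by norm_num)]
    exact Finset.sum_eq_zero fun i _ => hmean i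
  rw [variance_of_integral_eq_zero hmsum.1.aemeasurable hzero] at hsum
  have : ∀ ω, empMean (fun i => X i ω) n f ^ 2 =
      ((n : ℝ)⁻¹) ^ 2 * (∑ i ∈ Finset.range n, f ∘ X i) ω ^ 2 := fun ω => by
    simp [empMean, mul_pow]
  simp_rw [this]
  rw [integral_const_mul, hsum]
  -- For n = 0 both sides vanish because the inverse of 0 is 0.
  rcases eq_or_ne n 0 with rfl | hn
  · simp
  · field_simp

theorem lintegral_empMean_sq [IsProbabilityMeasure P] (hX : ∀ i, HasLaw (X i) μ P) (hindep : iIndepFun X P) {f : 𝒳 → ℝ}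
    (hf : MemL20 μ f) (n : ℕ) :
    ∫⁻ ω, ENNReal.ofReal (empMean (fun i => X i ω) n f ^ 2) ∂P =
      ENNReal.ofReal ((n : ℝ)⁻¹ * ∫ x, f x ^ 2 ∂μ) := by
  rw [← integral_empMean_sq hX hindep hf n, ofReal_integral_eq_lintegral_ofReal
    (memLp_empMean hX hf.1 n).integrable_sq (ae_of_all _ fun ω => sq_nonneg _)]

/-- Chebyshev's inequality. -/
theorem measure_lt_abs_empMean_le [IsProbabilityMeasure P] (hX : ∀ i, HasLaw (X i) μ P) (hindep : iIndepFun X P)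
    {f : 𝒳 → ℝ} (hf : MemL20 μ f) (n : ℕ) {a v : ℝ} (ha : 0 < a)
    (hv : (n : ℝ)⁻¹ * ∫ x, f x ^ 2 ∂μ ≤ v * a ^ 2) :
    P {ω | a < |empMean (fun i => X i ω) n f|} ≤ ENNReal.ofReal v := by
  have hmk := meas_ge_le_lintegral_div (μ := P)
    (f := fun ω => ENNReal.ofReal (empMean (fun i => X i ω) n f ^ 2))
    ((memLp_empMean hX hf.1 n).1.aemeasurable.pow_const 2).ennreal_ofReal
    (ε := ENNReal.ofReal (a ^ 2)) (by simpa using ha.ne') ENNReal.ofReal_ne_top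
  refine (measure_mono fun ω hω => ?_).trans (hmk.trans ?_)
  · refine ENNReal.ofReal_le_ofReal ?_
    rw [← sq_abs (empMean _ _ _)]
    exact pow_le_pow_left₀ ha.le (le_of_lt hω) 2
  · rw [lintegral_empMean_sq hX hindep hf n, ← ENNReal.ofReal_div_of_pos (by positivity)]
    apply ENNReal.ofReal_le_ofReal
    rwa [div_le_iff₀ (by positivity)]

/-- The squared dual norm of the empirical process over an orthogonal system with squared
norms `d`. -/
noncomputable def empDual (x : ℕ → 𝒳) (n : ℕ) (f : ℕ → 𝒳 → ℝ) (d : ℕ → ℝ) : ENNReal :=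
  ∑' i, ENNReal.ofReal (empMean x n (f i) ^ 2 / d i)

/-- Markov's inequality, with the expectation computed termwise by Tonelli; only the variance of
each term enters. -/
theorem measure_le_empDual_le [IsProbabilityMeasure P] (hX : ∀ i, HasLaw (X i) μ P) (hindep : iIndepFun X P)
    {f : ℕ → 𝒳 → ℝ} (hf : ∀ i, MemL20 μ (f i)) {d : ℕ → ℝ} {C S : ℝ}
    (hC : ∀ i, ∫ x, f i x ^ 2 ∂μ ≤ C) (hC0 : 0 ≤ C)
    (hS : ∑' i, ENNReal.ofReal (1 / d i) ≤ ENNReal.ofReal S) (n : ℕ) {w v : ℝ} (hw : 0 < w)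
    (hv : (n : ℝ)⁻¹ * C * S ≤ v * w) :
    P {ω | ENNReal.ofReal w ≤ empDual (fun i => X i ω) n f d} ≤ ENNReal.ofReal v := by
  have hmeas : ∀ i, AEMeasurable
      (fun ω => ENNReal.ofReal (empMean (fun j => X j ω) n (f i) ^ 2 / d i)) P := fun i =>
    (((memLp_empMean hX (hf i).1 n).1.aemeasurable.pow_const 2).div_const _).ennreal_ofReal
  have hle : ∫⁻ ω, empDual (fun i => X i ω) n f d ∂P ≤ ENNReal.ofReal ((n : ℝ)⁻¹ * C * S) := by
    simp only [empDual]
    rw [lintegral_tsum hmeas]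
    calc _ ≤ ∑' i, ENNReal.ofReal ((n : ℝ)⁻¹ * C) * ENNReal.ofReal (1 / d i) := by
          refine ENNReal.tsum_le_tsum fun i => ?_
          have : ∀ ω, ENNReal.ofReal (empMean (fun j => X j ω) n (f i) ^ 2 / d i) =
              ENNReal.ofReal (empMean (fun j => X j ω) n (f i) ^ 2) * ENNReal.ofReal (1 / d i) :=
            fun ω => by rw [← ENNReal.ofReal_mul (sq_nonneg _)]; congr 1; ring
          simp_rw [this]
          rw [lintegral_mul_const' _ _ ENNReal.ofReal_ne_top, lintegral_empMean_sq hX hindep (hf i)]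
          gcongr
          exact hC i
      _ = ENNReal.ofReal ((n : ℝ)⁻¹ * C) * ∑' i, ENNReal.ofReal (1 / d i) :=
          ENNReal.tsum_mul_left
      _ ≤ ENNReal.ofReal ((n : ℝ)⁻¹ * C) * ENNReal.ofReal S := by gcongr
      _ = _ := (ENNReal.ofReal_mul (by positivity)).symm
  refine (meas_ge_le_lintegral_div (μ := P) (AEMeasurable.tsum hmeas)
    (ε := ENNReal.ofReal w) (by simpa using hw) ENNReal.ofReal_ne_top).trans ?_
  refine (ENNReal.div_le_div_right hle _).trans ?_
  rw [← ENNReal.ofReal_div_of_pos hw]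
  apply ENNReal.ofReal_le_ofReal
  rwa [div_le_iff₀ hw]

end Empirical

/-- A continuous linear functional is bounded by its dual norm over a complete orthogonal
system. -/
theorem sq_le_mul_of_orthogonal {H : Type*} [NormedAddCommGroup H] [NormedSpace ℝ H]
    (B : LinearMap.BilinForm ℝ H) (hB : Continuous fun g => B g g) {φ : ℕ → H} {d : ℕ → ℝ}
    (hd : ∀ i, 0 < d i) (hφ : ∀ i j, B (φ i) (φ j) = if i = j then d i else 0)
    (hcomplete : (Submodule.span ℝ (Set.range φ)).topologicalClosure = ⊤) (ℓ : H →L[ℝ] ℝ) {w : ℝ}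
    (hw : 0 ≤ w) (hℓ : ∑' i, ENNReal.ofReal (ℓ (φ i) ^ 2 / d i) ≤ ENNReal.ofReal w) (g : H) :
    ℓ g ^ 2 ≤ w * B g g := by
  -- Both sides are continuous in g, so finite combinations suffice; on these the bound is
  -- Cauchy–Schwarz with weights d.
  have hclosed : IsClosed {g : H | ℓ g ^ 2 ≤ w * B g g} :=
    isClosed_le (ℓ.continuous.pow 2) (continuous_const.mul hB)
  have hspan : (Submodule.span ℝ (Set.range φ) : Set H) ⊆ {g : H | ℓ g ^ 2 ≤ w * B g g} := by
    intro g hg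
    obtain ⟨c, rfl⟩ := Finsupp.mem_span_range_iff_exists_finsupp.1 hg
    simp only [Finsupp.sum, Set.mem_ofPred_eq]
    have e1 : ℓ (∑ i ∈ c.support, c i • φ i) = ∑ i ∈ c.support, c i * ℓ (φ i) := by simp
    have e2 : B (∑ i ∈ c.support, c i • φ i) (∑ i ∈ c.support, c i • φ i) =
        ∑ i ∈ c.support, c i ^ 2 * d i := by
      simp only [map_sum, map_smul, LinearMap.sum_apply, LinearMap.smul_apply, smul_eq_mul, hφ]
      refine Finset.sum_congr rfl fun i hi => ?_
      rw [Finset.sum_eq_single i]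
      · simp; ring
      · intro j _ hji; simp [hji]
      · intro h; exact absurd hi h
    rw [e1, e2, mul_comm w]
    have hsum : ∑ i ∈ c.support, ℓ (φ i) ^ 2 / d i ≤ w := by
      have h1 := (ENNReal.sum_le_tsum c.support).trans hℓ
      rw [← ENNReal.ofReal_sum_of_nonneg (fun i _ => div_nonneg (sq_nonneg _) (hd i).le)] at h1
      exact (ENNReal.ofReal_le_ofReal_iff hw).1 h1
    refine (Finset.sum_sq_le_sum_mul_sum_of_sq_le_mul c.support
      (f := fun i => c i ^ 2 * d i) (g := fun i => ℓ (φ i) ^ 2 / d i)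
      (fun i _ => mul_nonneg (sq_nonneg _) (hd i).le)
      (fun i _ => div_nonneg (sq_nonneg _) (hd i).le) (fun i _ => ?_)).trans ?_
    · have := (hd i).ne'
      exact le_of_eq (by field_simp)
    · exact mul_le_mul_of_nonneg_left hsum
        (Finset.sum_nonneg fun i _ => mul_nonneg (sq_nonneg _) (hd i).le)
  have := closure_minimal hspan hclosed
  rw [← Submodule.topologicalClosure_coe, hcomplete] at this
  exact this (Set.mem_univ g)

/-! ### Positive semidefinite forms. -/

section Form

variable {H : Type*} [NormedAddCommGroup H] [NormedSpace ℝ H] {J : LinearMap.BilinForm ℝ H}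

theorem sq_apply_le_of_isPosSemidef {M : Type*} [AddCommGroup M] [Module ℝ M]
    {B : LinearMap.BilinForm ℝ M} (hB : B.IsPosSemidef) (x y : M) :
    B x y ^ 2 ≤ B x x * B y y :=
  LinearMap.BilinForm.apply_sq_le_of_symm B hB.nonneg
    (LinearMap.BilinForm.isSymm_iff.1 hB.isSymm) x y

/-- Cauchy–Schwarz upgrades the bound on the diagonal to boundedness of the bilinear form. -/
theorem continuous_apply_self_of_le (hJ : J.IsPosSemidef) {M : ℝ} (hM : 0 ≤ M)
    (h : ∀ g, J g g ≤ M * ‖g‖ ^ 2) : Continuous fun g => J g g := by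
  have hb : ∀ x y, ‖J x y‖ ≤ M * ‖x‖ * ‖y‖ := by
    intro x y
    rw [Real.norm_eq_abs]
    apply abs_le_of_sq_le_sq _ (by positivity)
    calc J x y ^ 2 ≤ J x x * J y y := sq_apply_le_of_isPosSemidef hJ x y
      _ ≤ (M * ‖x‖ ^ 2) * (M * ‖y‖ ^ 2) :=
          mul_le_mul (h x) (h y) (hJ.nonneg y) (by positivity)
      _ = _ := by ring
  have : (fun g => J g g) = fun g => (J.mkContinuous₂ M hb) g g := by
    ext g; simp
  rw [this]
  fun_prop

/-- The convexity gap is a b B(x - y, x - y). -/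
theorem convexOn_apply_self {M : Type*} [AddCommGroup M] [Module ℝ M]
    {B : LinearMap.BilinForm ℝ M} (hB : B.IsPosSemidef) :
    ConvexOn ℝ Set.univ fun g => B g g := by
  refine ⟨convex_univ, fun x _ y _ a b ha hb hab => ?_⟩
  have h1 := hB.nonneg (x - y)
  have h2 : B y x = B x y := hB.isSymm.eq y x
  simp only [map_sub, map_add, map_smul, LinearMap.sub_apply, LinearMap.add_apply,
    LinearMap.smul_apply, smul_eq_mul, h2] at h1 ⊢
  have hb' : b = 1 - a := by linarith
  subst hb'
  nlinarith [mul_nonneg (mul_nonneg ha hb) h1]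

end Form

/-! ### Auxiliary operators, their equivalence, and the eigensystem. -/

section Operators

variable {E H 𝒳 : Type*} [NormedAddCommGroup E] [NormedSpace ℝ E] [NormedAddCommGroup H]
  [NormedSpace ℝ H] [MeasurableSpace 𝒳] {μ : Measure 𝒳} [IsFiniteMeasure μ]
  {J : LinearMap.BilinForm ℝ H}

theorem Vcov_eq_inner (f g : L20 μ) : Vcov f g = inner ℝ f g := by
  change Vcov f g = inner ℝ (f : Lp ℝ 2 μ) (g : Lp ℝ 2 μ)
  rw [L2.inner_def, Vcov, covariance]
  have h1 : ∫ x, L20fn f x ∂μ = 0 := f.2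
  have h2 : ∫ x, L20fn g x ∂μ = 0 := g.2
  rw [h1, h2]
  refine integral_congr_ae (ae_of_all _ fun x => ?_)
  simp [L20fn, mul_comm]

theorem V_nonneg (f : L20 μ) : 0 ≤ V f := variance_nonneg _ _

theorem V_smul (c : ℝ) (f : L20 μ) : V (c • f) = c ^ 2 * V f := by
  rw [V_eq_norm_sq, V_eq_norm_sq, norm_smul, mul_pow, Real.norm_eq_abs, sq_abs]

/-- Homogeneous form of the separation condition: rescale ζ to the unit sphere and use -g/‖ζ‖. -/
theorem OperatorCondition.exists_le {Lθ : E →L[ℝ] L20 μ} {Lh : H →L[ℝ] L20 μ}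
    (hL : OperatorCondition J Lθ Lh) :
    ∃ c : ℝ, 0 < c ∧ ∀ ζ g, c * ‖ζ‖ ^ 2 ≤ ‖Lθ ζ + Lh g‖ ^ 2 := by
  obtain ⟨c, hc, h⟩ := hL.separation
  refine ⟨c, hc, fun ζ g => ?_⟩
  rcases eq_or_ne ζ 0 with rfl | hζ
  · simp
  have hn : ‖ζ‖ ≠ 0 := norm_ne_zero_iff.2 hζ
  have h1 := h (‖ζ‖⁻¹ • ζ) (by rw [norm_smul, norm_inv, norm_norm, inv_mul_cancel₀ hn])
    (-(‖ζ‖⁻¹ • g))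
  have h2 : Lθ (‖ζ‖⁻¹ • ζ) - Lh (-(‖ζ‖⁻¹ • g)) = ‖ζ‖⁻¹ • (Lθ ζ + Lh g) := by
    simp [smul_add]
  rw [h2, V_smul, V_eq_norm_sq] at h1
  have h3 : c * ‖ζ‖ ^ 2 < (‖ζ‖⁻¹ ^ 2 * ‖Lθ ζ + Lh g‖ ^ 2) * ‖ζ‖ ^ 2 := by gcongr
  refine h3.le.trans (le_of_eq ?_)
  field_simp

/-- The admissibility conditions are inherited by equivalent operators. -/
theorem OperatorCondition.of_equiv {Lθ Lθ' : E →L[ℝ] L20 μ} {Lh Lh' : H →L[ℝ] L20 μ}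
    (hL : OperatorCondition J Lθ Lh) (hJ : J.IsPosSemidef) {C₁ C₂ : ℝ} (hC₁ : 0 < C₁) (hC₂ : 0 < C₂)
    (h : ∀ ζ g, C₁ * V (Lθ ζ + Lh g) ≤ V (Lθ' ζ + Lh' g) ∧
      V (Lθ' ζ + Lh' g) ≤ C₂ * V (Lθ ζ + Lh g)) : OperatorCondition J Lθ' Lh' where
  injective_Lθ := by
    rw [injective_iff_map_eq_zero]
    intro ζ hζ
    have := (h ζ 0).1
    rw [map_zero, map_zero, add_zero, add_zero, hζ, V_eq_norm_sq, V_eq_norm_sq] at this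
    have h0 : ‖Lθ ζ‖ ^ 2 = 0 := by
      simp only [norm_zero] at this
      nlinarith [sq_nonneg ‖Lθ ζ‖]
    exact (injective_iff_map_eq_zero _).1 hL.injective_Lθ ζ (by simpa using h0)
  injective_Lh := by
    rw [injective_iff_map_eq_zero]
    intro g hg
    have := (h 0 g).1
    rw [map_zero, map_zero, zero_add, zero_add, hg, V_eq_norm_sq, V_eq_norm_sq] at this
    have h0 : ‖Lh g‖ ^ 2 = 0 := by
      simp only [norm_zero] at this
      nlinarith [sq_nonneg ‖Lh g‖]
    exact (injective_iff_map_eq_zero _).1 hL.injective_Lh g (by simpa using h0)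
  norm_equiv := by
    intro lam hlam
    obtain ⟨M₁, M₂, hM₁, hM₂, hM⟩ := hL.norm_equiv lam hlam
    refine ⟨min C₁ 1 * M₁, max C₂ 1 * M₂, by positivity, by positivity, fun g => ?_⟩
    have hg := h 0 g
    rw [map_zero, map_zero, zero_add, zero_add] at hg
    have hV := V_nonneg (Lh g)
    have hj : 0 ≤ lam * J g g := mul_nonneg hlam.le (hJ.nonneg g)
    obtain ⟨h1, h2⟩ := hM g
    constructor
    · calc min C₁ 1 * M₁ * ‖g‖ ^ 2 = min C₁ 1 * (M₁ * ‖g‖ ^ 2) := by ring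
        _ ≤ min C₁ 1 * (V (Lh g) + lam * J g g) := by gcongr
        _ = min C₁ 1 * V (Lh g) + min C₁ 1 * (lam * J g g) := by ring
        _ ≤ C₁ * V (Lh g) + 1 * (lam * J g g) := by
            gcongr
            · exact min_le_left _ _
            · exact min_le_right _ _
        _ ≤ _ := by linarith [hg.1]
    · calc V (Lh' g) + lam * J g g ≤ C₂ * V (Lh g) + 1 * (lam * J g g) := by linarith [hg.2]
        _ ≤ max C₂ 1 * V (Lh g) + max C₂ 1 * (lam * J g g) := by
            gcongr
            · exact le_max_left _ _
            · exact le_max_right _ _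
        _ = max C₂ 1 * (V (Lh g) + lam * J g g) := by ring
        _ ≤ max C₂ 1 * (M₂ * ‖g‖ ^ 2) := by gcongr
        _ = _ := by ring
  separation := by
    obtain ⟨c, hc, hs⟩ := hL.separation
    refine ⟨C₁ * c, by positivity, fun ζ hζ g => ?_⟩
    have h1 := hs ζ hζ g
    have h2 := (h ζ (-g)).1
    rw [map_neg, map_neg, ← sub_eq_add_neg, ← sub_eq_add_neg] at h2
    exact (mul_lt_mul_of_pos_left h1 hC₁).trans_le h2

theorem CompletelyContinuous.of_le {B B' A : H → ℝ} (h : CompletelyContinuous B A) {C : ℝ}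
    (hC : 0 < C) (hB : ∀ g, B' g ≤ C * B g) : CompletelyContinuous B' A := by
  intro ε hε
  obtain ⟨k, l, hl⟩ := h (ε / C) (by positivity)
  refine ⟨k, l, fun g hg => (hB g).trans ?_⟩
  calc C * B g ≤ C * (ε / C * A g) := by gcongr; exact hl g hg
    _ = ε * A g := by field_simp

/-- The squared norm `V(Lh g) + lam J(g)` as a quadratic form. -/
noncomputable def penForm (Lh : H →L[ℝ] L20 μ) (J : LinearMap.BilinForm ℝ H) (lam : ℝ) :
    LinearMap.BilinForm ℝ H :=
  (innerₗ (L20 μ)).compl₁₂ (Lh : H →ₗ[ℝ] L20 μ) (Lh : H →ₗ[ℝ] L20 μ) + lam • J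

theorem penForm_apply (Lh : H →L[ℝ] L20 μ) (J : LinearMap.BilinForm ℝ H) (lam : ℝ) (x y : H) :
    penForm Lh J lam x y = inner ℝ (Lh x) (Lh y) + lam * J x y := by
  simp [penForm]

/-- A continuous functional is controlled by its coefficients in the eigensystem. -/
theorem IsEigensystem.sq_le {Lθ : E →L[ℝ] L20 μ} {Lh : H →L[ℝ] L20 μ} {φ : ℕ → H} {ρ : ℕ → ℝ}
    (hφ : IsEigensystem J Lh φ ρ) (hL : OperatorCondition J Lθ Lh) (hJ : J.IsPosSemidef)
    {lam : ℝ} (hlam : 0 < lam) (ℓ : H →L[ℝ] ℝ) {w : ℝ} (hw : 0 ≤ w)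
    (hℓ : ∑' i, ENNReal.ofReal (ℓ (φ i) ^ 2 / (1 + lam * ρ i)) ≤ ENNReal.ofReal w) (g : H) :
    ℓ g ^ 2 ≤ w * (V (Lh g) + lam * J g g) := by
  obtain ⟨M₁, M₂, hM₁, hM₂, hM⟩ := hL.norm_equiv 1 one_pos
  have hJc : Continuous fun g => J g g := continuous_apply_self_of_le hJ hM₂.le fun g => by
    have := (hM g).2
    have := V_nonneg (Lh g)
    linarith
  have hself : ∀ g, penForm Lh J lam g g = V (Lh g) + lam * J g g := fun g => by
    rw [penForm_apply, real_inner_self_eq_norm_sq, V_eq_norm_sq]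
  have hρ : ∀ i, 0 ≤ ρ i := fun i => by
    have := hφ.diagonal i i
    rw [if_pos rfl] at this
    rw [← this]; exact hJ.nonneg _
  have := sq_le_mul_of_orthogonal (penForm Lh J lam) (by
      simp_rw [hself, V_eq_norm_sq]
      exact (by fun_prop : Continuous fun g => ‖Lh g‖ ^ 2).add (continuous_const.mul hJc)) (φ := φ) (d := fun i => 1 + lam * ρ i)
    (fun i => by have := hρ i; positivity) (fun i j => by
      rw [penForm_apply, ← Vcov_eq_inner, hφ.orthonormal, hφ.diagonal]
      split_ifs <;> simp) hφ.complete ℓ hw hℓ g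
  rwa [hself] at this

/-- A nonzero centred function is neither almost everywhere nonpositive nor almost everywhere
nonnegative, so its positivity set works. This supplies the set `B₀` needed to bound the density
ratios. -/
theorem exists_measurableSet_of_V_ne_zero {f : L20 μ} (hf : V f ≠ 0) :
    ∃ B, MeasurableSet B ∧ μ B ≠ 0 ∧ μ Bᶜ ≠ 0 := by
  have hm : StronglyMeasurable (L20fn f) := Lp.stronglyMeasurable _
  have hi : Integrable (L20fn f) μ := (memL20_L20fn f).1.integrable (by norm_num)
  have h0 : ∫ x, L20fn f x ∂μ = 0 := f.2
  have key : ¬ (L20fn f =ᵐ[μ] 0) := fun h => hf (by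
    rw [V, variance_congr h, variance_zero])
  refine ⟨{x | 0 < L20fn f x}, measurableSet_lt measurable_const hm.measurable, fun h => ?_,
    fun h => ?_⟩
  · have hle : ∀ᵐ x ∂μ, L20fn f x ≤ 0 := by
      filter_upwards [measure_eq_zero_iff_ae_notMem.1 h] with x hx
      exact not_lt.1 hx
    apply key
    have h1 : ∫ x, -L20fn f x ∂μ = 0 := by rw [integral_neg, h0, neg_zero]
    have h2 := (integral_eq_zero_iff_of_nonneg_ae (by
      filter_upwards [hle] with x hx
      simpa using hx) hi.neg).1 h1
    filter_upwards [h2] with x hx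
    simpa using hx
  · have hle : ∀ᵐ x ∂μ, 0 ≤ L20fn f x := by
      filter_upwards [measure_eq_zero_iff_ae_notMem.1 h] with x hx
      exact (not_not.1 hx : 0 < L20fn f x).le
    exact key ((integral_eq_zero_iff_of_nonneg_ae hle hi).1 h0)

end Operators

/-! ### Partial derivatives of a map affine in `h`. -/

section Deriv

variable {E H G : Type*} [NormedAddCommGroup E] [NormedSpace ℝ E] [NormedAddCommGroup H]
  [NormedSpace ℝ H] [NormedAddCommGroup G] [NormedSpace ℝ G] {F : E × H → G}

theorem hasFDerivAt_Dθ {τ : E × H} (hF : DifferentiableAt ℝ F τ) :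
    HasFDerivAt (fun θ => F (θ, τ.2)) (Dθ F τ) τ.1 := by
  have h1 : HasFDerivAt (fun θ : E => (θ, τ.2)) (ContinuousLinearMap.inl ℝ E H) τ.1 :=
    hasFDerivAt_prodMk_left _ _
  exact (HasFDerivAt.comp τ.1 (by exact hF.hasFDerivAt) h1).differentiableAt.hasFDerivAt

theorem hasFDerivAt_Dh {τ : E × H} (hF : DifferentiableAt ℝ F τ) :
    HasFDerivAt (fun h => F (τ.1, h)) (Dh F τ) τ.2 := by
  have h1 : HasFDerivAt (fun h : H => (τ.1, h)) (ContinuousLinearMap.inr ℝ E H) τ.2 :=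
    hasFDerivAt_prodMk_right _ _
  exact (HasFDerivAt.comp τ.2 (by exact hF.hasFDerivAt) h1).differentiableAt.hasFDerivAt

/-- Differentiate along the line t ↦ h + t g. No continuity of `ι` is assumed, so the lemma makes an
algebraic linear part bounded. -/
theorem Dh_apply_of_affine {ι : H →ₗ[ℝ] G} (haff : ∀ θ h g, F (θ, h + g) = F (θ, h) + ι g)
    {τ : E × H} (hF : DifferentiableAt ℝ F τ) (g : H) : Dh F τ g = ι g := by
  have h1 := hasFDerivAt_Dh hF
  have h2 : HasDerivAt (fun t : ℝ => τ.2 + t • g) g 0 := by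
    simpa using ((hasDerivAt_id (0 : ℝ)).smul_const g).const_add τ.2
  have h1' : HasFDerivAt (fun h => F (τ.1, h)) (Dh F τ) (τ.2 + (0 : ℝ) • g) := by simpa using h1
  have h3 := HasFDerivAt.comp_hasDerivAt (l := fun h => F (τ.1, h)) (l' := Dh F τ) (0 : ℝ) h1' h2
  have h4 : HasDerivAt (fun t : ℝ => F (τ.1, τ.2 + t • g)) (ι g) 0 := by
    have : (fun t : ℝ => F (τ.1, τ.2 + t • g)) = fun t : ℝ => F (τ.1, τ.2) + t • ι g := by
      ext t; rw [haff, map_smul]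
    rw [this]
    simpa using ((hasDerivAt_id (0 : ℝ)).smul_const (ι g)).const_add (F (τ.1, τ.2))
  exact h3.unique h4

end Deriv

/-! ### Likelihood increments and localization by convexity. -/

section Likelihood

/-- The difference of log likelihoods in terms of the empirical process and the
Kullback–Leibler divergence. -/
theorem negLogLik_sub {E H 𝒳 : Type*} [MeasurableSpace 𝒳] {ν : Measure 𝒳} [NeZero ν]
    {η : E × H → 𝒳 → ℝ} {τ τ₀ : E × H} (h : Integrable (fun x => Real.exp (η τ x)) ν)
    (h₀ : Integrable (fun x => Real.exp (η τ₀ x)) ν) (x : ℕ → 𝒳) (n : ℕ) :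
    negLogLik ν η x n τ - negLogLik ν η x n τ₀ =
      Real.log (∫ y, Real.exp (η τ y - η τ₀ y) ∂(ν.tilted (η τ₀))) -
        empMean x n (fun y => η τ y - η τ₀ y) := by
  have e : ∫ y, Real.exp (η τ y - η τ₀ y) ∂(ν.tilted (η τ₀)) =
      (∫ y, Real.exp (η τ y) ∂ν) / ∫ y, Real.exp (η τ₀ y) ∂ν := by
    rw [integral_exp_tilted]; simp
  rw [e, Real.log_div (integral_exp_pos h).ne' (integral_exp_pos h₀).ne', negLogLik, negLogLik,
    empMean, Finset.sum_sub_distrib]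
  ring

/-- Along the segment from `τ₀` to a point where a convex function is not larger, every intermediate
value of a homogeneous function is attained. -/
theorem exists_scaled_of_convexOn {Q : Type*} [AddCommGroup Q] [Module ℝ Q] {N : Set Q}
    {f : Q → ℝ} (hf : ConvexOn ℝ N f) {τ₀ τ : Q} (hτ₀ : τ₀ ∈ N) (hτ : τ ∈ N) (hle : f τ ≤ f τ₀)
    {p : Q → ℝ} (hp : ∀ (t : ℝ) (v : Q), 0 ≤ t → p (t • v) = t * p v) {d : ℝ} (hd : 0 ≤ d)
    (hlt : d < p (τ - τ₀)) : ∃ v, p v = d ∧ τ₀ + v ∈ N ∧ f (τ₀ + v) ≤ f τ₀ := by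
  have hp0 : 0 < p (τ - τ₀) := hd.trans_lt hlt
  set t := d / p (τ - τ₀) with ht
  have ht0 : 0 ≤ t := by positivity
  have ht1 : 0 ≤ 1 - t := by rw [sub_nonneg, ht, div_le_one hp0]; exact hlt.le
  have e : τ₀ + t • (τ - τ₀) = (1 - t) • τ₀ + t • τ := by
    rw [smul_sub, sub_smul, one_smul]; abel
  refine ⟨t • (τ - τ₀), ?_, ?_, ?_⟩
  · rw [hp _ _ ht0, ht]; field_simp
  · rw [e]; exact hf.1 hτ₀ hτ ht1 ht0 (by ring)
  · rw [e]
    have := hf.2 hτ₀ hτ ht1 ht0 (by ring)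
    simp only [smul_eq_mul] at this
    nlinarith

end Likelihood

/-- Local bounds for a map that is affine in its second argument. -/
theorem exists_local_bounds {E H G : Type*} [NormedAddCommGroup E] [NormedSpace ℝ E]
    [NormedAddCommGroup H] [NormedSpace ℝ H] [NormedAddCommGroup G] [NormedSpace ℝ G]
    {F : E × H → G} {D : E →L[ℝ] G} {ι : H →L[ℝ] G} {θ₀ : E} {h₀ : H}
    (haff : ∀ θ h g, F (θ, h + g) = F (θ, h) + ι g)
    (hD : HasFDerivAt (fun θ => F (θ, h₀)) D θ₀)
    (hF : ContDiffAt ℝ 1 (fun θ => F (θ, h₀)) θ₀) {c : ℝ} (hc : 0 < c)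
    (hcD : ∀ ζ g, c * ‖ζ‖ ^ 2 ≤ ‖D ζ + ι g‖ ^ 2) {Nθ : Set E} (hNθ : Nθ ∈ 𝓝 θ₀) :
    ∃ r : ℝ, 0 < r ∧ ∃ L : ℝ, 0 < L ∧ (∀ ζ, ‖ζ‖ ≤ r → θ₀ + ζ ∈ Nθ) ∧
      (∀ ζ g, ‖ζ‖ ≤ r → ‖D ζ + ι g‖ ≤ 2 * ‖F (θ₀ + ζ, h₀ + g) - F (θ₀, h₀)‖) ∧
      (∀ ζ ζ', ‖ζ‖ ≤ r → ‖ζ'‖ ≤ r →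
        ‖F (θ₀ + ζ, h₀) - F (θ₀ + ζ', h₀)‖ ≤ L * ‖ζ - ζ'‖) := by
  obtain ⟨K, t, ht, hK⟩ := hF.exists_lipschitzOnWith
  -- Since √c ‖ζ‖ ≤ ‖D ζ + ι g‖, a remainder of size (√c/2) ‖ζ‖ is absorbed into half of the left
  -- side. Only ζ has to be small; g is arbitrary because F is affine in it.
  have hκ : 0 < √c / 2 := by positivity
  have hlo : ∀ᶠ θ in 𝓝 θ₀, ‖F (θ, h₀) - F (θ₀, h₀) - D (θ - θ₀)‖ ≤ √c / 2 * ‖θ - θ₀‖ :=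
    hD.isLittleO.def hκ
  obtain ⟨r, hr, hball⟩ := Metric.nhds_basis_closedBall.mem_iff.1
    (Filter.inter_mem (Filter.inter_mem hNθ ht) hlo)
  have hmem : ∀ ζ : E, ‖ζ‖ ≤ r → θ₀ + ζ ∈ (Nθ ∩ t) ∩
      {θ | ‖F (θ, h₀) - F (θ₀, h₀) - D (θ - θ₀)‖ ≤ √c / 2 * ‖θ - θ₀‖} := fun ζ hζ =>
    hball (by simpa [Metric.mem_closedBall, dist_eq_norm] using hζ)
  refine ⟨r, hr, K + 1, by positivity, fun ζ hζ => (hmem ζ hζ).1.1, fun ζ g hζ => ?_,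
    fun ζ ζ' hζ hζ' => ?_⟩
  · have h1 : ‖F (θ₀ + ζ, h₀) - F (θ₀, h₀) - D (θ₀ + ζ - θ₀)‖ ≤ √c / 2 * ‖θ₀ + ζ - θ₀‖ :=
      (hmem ζ hζ).2
    rw [add_sub_cancel_left] at h1
    have h2 : √c * ‖ζ‖ ≤ ‖D ζ + ι g‖ := by
      have := Real.sqrt_le_sqrt (hcD ζ g)
      rwa [Real.sqrt_mul hc.le, Real.sqrt_sq (norm_nonneg _), Real.sqrt_sq (norm_nonneg _)] at this
    have h3 : D ζ + ι g = (F (θ₀ + ζ, h₀ + g) - F (θ₀, h₀)) -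
        (F (θ₀ + ζ, h₀) - F (θ₀, h₀) - D ζ) := by rw [haff]; abel
    have h4 := norm_sub_le (F (θ₀ + ζ, h₀ + g) - F (θ₀, h₀)) (F (θ₀ + ζ, h₀) - F (θ₀, h₀) - D ζ)
    rw [← h3] at h4
    linarith
  · have := hK.norm_sub_le (hmem ζ hζ).1.2 (hmem ζ' hζ').1.2
    rw [add_sub_add_left_eq_sub] at this
    refine this.trans ?_
    gcongr
    simp

/-- If the penalized likelihood increases on a sphere around `τ₀`, then the estimator lies within
the sphere. -/
theorem IsEstimator.sqrt_le {E H G 𝒳 : Type*} [NormedAddCommGroup E] [NormedSpace ℝ E]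
    [NormedAddCommGroup H] [NormedSpace ℝ H] [NormedAddCommGroup G] [NormedSpace ℝ G]
    [MeasurableSpace 𝒳] {ν : Measure 𝒳} {η : E × H → 𝒳 → ℝ} {J : LinearMap.BilinForm ℝ H}
    {N : Set (E × H)} {lam : ℝ} {x : ℕ → 𝒳} {n : ℕ} {τhat τ₀ : E × H}
    (hest : IsEstimator ν η J N lam x n τhat) (hJ : J.IsPosSemidef) (hlam : 0 < lam)
    (hτ₀ : τ₀ ∈ N) {D : E →L[ℝ] G} {ι : H →L[ℝ] G} {K q : E × H → ℝ}
    (hK : ∀ τ ∈ N, negLogLik ν η x n τ - negLogLik ν η x n τ₀ = K τ - q τ) {c d : ℝ} (hd : 0 ≤ d)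
    (hlow : ∀ v : E × H, τ₀ + v ∈ N → ‖D v.1 + ι v.2‖ ^ 2 + lam * J v.2 v.2 = d ^ 2 →
      c * d ^ 2 ≤ K (τ₀ + v) + lam / 2 * J v.2 v.2)
    (hemp : ∀ v : E × H, τ₀ + v ∈ N → ‖D v.1 + ι v.2‖ ^ 2 + lam * J v.2 v.2 = d ^ 2 →
      |q (τ₀ + v)| + |lam * J τ₀.2 v.2| < c * d ^ 2) :
    √(‖D (τhat - τ₀).1 + ι (τhat - τ₀).2‖ ^ 2 + lam * J (τhat - τ₀).2 (τhat - τ₀).2) ≤ d := by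
  set p : E × H → ℝ := fun v => √(‖D v.1 + ι v.2‖ ^ 2 + lam * J v.2 v.2) with hp
  change p (τhat - τ₀) ≤ d
  by_contra! hlt
  have hnn : ∀ v : E × H, 0 ≤ ‖D v.1 + ι v.2‖ ^ 2 + lam * J v.2 v.2 := fun v =>
    add_nonneg (sq_nonneg _) (mul_nonneg hlam.le (hJ.nonneg _))
  have hconvN : Convex ℝ N := hest.convexOn.1
  have hpen : ConvexOn ℝ N (fun τ : E × H => J τ.2 τ.2) :=
    ((convexOn_apply_self hJ).comp_linearMap (LinearMap.snd ℝ E H)).subset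
      (Set.subset_univ _) hconvN
  have hconv : ConvexOn ℝ N (penLik ν η J lam x n) :=
    hest.convexOn.add (hpen.smul (by positivity : 0 ≤ lam / 2))
  have hmin : penLik ν η J lam x n τhat ≤ penLik ν η J lam x n τ₀ :=
    IsMinOn.of_isLocalMinOn_of_convexOn hest.mem hest.isLocalMinOn hconv hτ₀
  have hhom : ∀ (t : ℝ) (v : E × H), 0 ≤ t → p (t • v) = t * p v := by
    intro t v ht
    simp only [hp, Prod.smul_fst, Prod.smul_snd, map_smul, LinearMap.smul_apply, smul_eq_mul]
    rw [← smul_add, norm_smul, mul_pow, Real.norm_eq_abs, sq_abs]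
    rw [show t ^ 2 * ‖D v.1 + ι v.2‖ ^ 2 + lam * (t * (t * J v.2 v.2)) =
      t ^ 2 * (‖D v.1 + ι v.2‖ ^ 2 + lam * J v.2 v.2) by ring, Real.sqrt_mul (sq_nonneg _),
      Real.sqrt_sq ht]
  obtain ⟨v, hv, hvN, hvle⟩ := exists_scaled_of_convexOn hconv hτ₀ hest.mem hmin hhom hd hlt
  have hv2 : ‖D v.1 + ι v.2‖ ^ 2 + lam * J v.2 v.2 = d ^ 2 := by
    rw [← hv, Real.sq_sqrt (hnn v)]
  have h1 := hlow v hvN hv2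
  have h2 := hemp v hvN hv2
  have h3 := hK _ hvN
  have h4 : J v.2 τ₀.2 = J τ₀.2 v.2 := hJ.isSymm.eq _ _
  -- Expanding the penalty at h₀ + g gives (λ/2) J(g, g), counted in the lower bound, and the cross
  -- term λ J(h₀, g), counted with the empirical part.
  simp only [penLik, Prod.snd_add, map_add, LinearMap.add_apply, h4] at hvle
  have h5 := neg_abs_le (lam * J τ₀.2 v.2)
  have h6 := le_abs_self (q (τ₀ + v))
  nlinarith

/-- Finitely many test points control the parametric part of the empirical process. -/
theorem abs_empMean_le_of_test_points {E H 𝒳 : Type*} [NormedAddCommGroup E] [NormedSpace ℝ E]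
    [AddCommGroup H] [Module ℝ H] [MeasurableSpace 𝒳] {ν : Measure 𝒳}
    {η : E × H → 𝒳 → ℝ} {N : Set (E × H)} {x : ℕ → 𝒳} {n : ℕ} {θ₀ : E} {h₀ : H} {K : E × H → ℝ}
    (hconv : ConvexOn ℝ N (negLogLik ν η x n))
    (hK : ∀ τ ∈ N, negLogLik ν η x n τ - negLogLik ν η x n (θ₀, h₀) =
      K τ - empMean x n (fun y => η τ y - η (θ₀, h₀) y))
    (hK0 : K (θ₀, h₀) = 0) {r A : ℝ} (hA : 0 ≤ A) (hrN : ∀ ζ : E, ‖ζ‖ ≤ r → (θ₀ + ζ, h₀) ∈ N)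
    (hKlip : ∀ ζ ζ' : E, ‖ζ‖ ≤ r → ‖ζ'‖ ≤ r →
      |K (θ₀ + ζ, h₀) - K (θ₀ + ζ', h₀)| ≤ A * (‖ζ - ζ'‖ * (‖ζ‖ + ‖ζ'‖)))
    {R C s : ℝ} (hR : 1 ≤ R) {T : Finset E}
    (hT : ∀ (q k : E → ℝ) (B Q : ℝ), 0 ≤ B → 0 ≤ Q →
        ConvexOn ℝ (Metric.closedBall 0 R) (fun x => k x - q x) → q 0 = 0 → k 0 = 0 →
        (∀ x ∈ Metric.closedBall (0 : E) R, ∀ y ∈ Metric.closedBall (0 : E) R,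
          |k x - k y| ≤ B * ‖x - y‖) →
        (∀ v ∈ T, |q v| ≤ Q) → ∀ x : E, ‖x‖ ≤ 1 → |q x| ≤ C * (Q + s * B))
    {ε Q : ℝ} (hε : 0 < ε) (hεr : R * ε ≤ r) (hQ : 0 ≤ Q)
    (htest : ∀ v ∈ T, |empMean x n (fun y => η (θ₀ + ε • v, h₀) y - η (θ₀, h₀) y)| ≤ Q)
    {ζ : E} (hζ : ‖ζ‖ ≤ ε) :
    |empMean x n (fun y => η (θ₀ + ζ, h₀) y - η (θ₀, h₀) y)| ≤
      C * (Q + s * (2 * A * R * ε ^ 2)) := by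
  have hscale : ∀ v : E, ‖v‖ ≤ R → ‖ε • v‖ ≤ r := fun v hv => by
    rw [norm_smul, Real.norm_of_nonneg hε.le]
    exact le_trans (by nlinarith) hεr
  -- After rescaling by ε, the second-order bound gives K the Lipschitz constant 2 A R ε² on the
  -- ball of radius R.
  have := hT (fun v => empMean x n (fun y => η (θ₀ + ε • v, h₀) y - η (θ₀, h₀) y))
    (fun v => K (θ₀ + ε • v, h₀)) (2 * A * R * ε ^ 2) Q (by positivity) hQ ?_ ?_ ?_ ?_ htest
    (ε⁻¹ • ζ) (by
      rw [norm_smul, norm_inv, Real.norm_of_nonneg hε.le, inv_mul_le_iff₀ hε]; linarith)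
  · simpa [smul_smul, hε.ne'] using this
  · refine ⟨convex_closedBall _ _, fun u hu v hv a b ha hb hab => ?_⟩
    have hmem : ∀ w ∈ Metric.closedBall (0 : E) R, (θ₀ + ε • w, h₀) ∈ N := fun w hw =>
      hrN _ (hscale w (by simpa using hw))
    have huv : a • u + b • v ∈ Metric.closedBall (0 : E) R := convex_closedBall _ _ hu hv ha hb hab
    have h1 := hconv.2 (hmem u hu) (hmem v hv) ha hb hab
    have e : a • (θ₀ + ε • u, h₀) + b • (θ₀ + ε • v, h₀) = (θ₀ + ε • (a • u + b • v), h₀) := by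
      have hb' : b = 1 - a := by linarith
      subst hb'
      ext
      · simp only [Prod.fst_add, Prod.smul_fst]; module
      · simp only [Prod.snd_add, Prod.smul_snd]; module
    rw [e] at h1
    have k1 := hK _ (hmem u hu)
    have k2 := hK _ (hmem v hv)
    have k3 := hK _ (hmem _ huv)
    simp only [smul_eq_mul] at h1 ⊢
    rw [← k1, ← k2, ← k3]
    have hb' : b = 1 - a := by linarith
    subst hb'
    linarith
  · simp [empMean]
  · simpa using hK0
  · intro u hu v hv
    have hu' : ‖u‖ ≤ R := by simpa using hu
    have hv' : ‖v‖ ≤ R := by simpa using hv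
    refine (hKlip _ _ (hscale u hu') (hscale v hv')).trans ?_
    rw [← smul_sub, norm_smul, norm_smul, norm_smul, Real.norm_of_nonneg hε.le]
    have : A * (ε * ‖u - v‖ * (ε * ‖u‖ + ε * ‖v‖)) = A * ε ^ 2 * ‖u - v‖ * (‖u‖ + ‖v‖) := by ring
    rw [this]
    calc A * ε ^ 2 * ‖u - v‖ * (‖u‖ + ‖v‖) ≤ A * ε ^ 2 * ‖u - v‖ * (R + R) := by gcongr
      _ = _ := by ring

/-! ### The rate and its elementary bounds. -/

/-- The rate `n^(-1/2) lam^(-1/(2r)) + lam^(1/2)`. -/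
noncomputable def rate (r : ℝ) (n : ℕ) (lam : ℝ) : ℝ :=
  (n : ℝ) ^ (-(1 / 2) : ℝ) * lam ^ (-(1 / (2 * r))) + lam ^ (1 / 2 : ℝ)

theorem rate_pos {r : ℝ} {n : ℕ} {lam : ℝ} (hlam : 0 < lam) : 0 < rate r n lam := by
  have := Real.rpow_pos_of_pos hlam (1 / 2)
  unfold rate
  positivity

theorem inv_mul_rpow_le_rate_sq {r : ℝ} {n : ℕ} {lam : ℝ} (hlam : 0 < lam) :
    (n : ℝ)⁻¹ * lam ^ (-(1 / r)) ≤ rate r n lam ^ 2 := by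
  have h1 : (n : ℝ)⁻¹ * lam ^ (-(1 / r)) =
      ((n : ℝ) ^ (-(1 / 2) : ℝ) * lam ^ (-(1 / (2 * r)))) ^ 2 := by
    rw [mul_pow, ← Real.rpow_natCast, ← Real.rpow_natCast, ← Real.rpow_mul (by positivity),
      ← Real.rpow_mul hlam.le, ← Real.rpow_neg_one]
    congr 2
    · norm_num
    · push_cast
      rw [one_div, one_div, mul_inv]
      ring
  rw [h1]
  have := Real.rpow_pos_of_pos hlam (1 / 2)
  exact pow_le_pow_left₀ (by positivity) (le_add_of_nonneg_right this.le) 2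

theorem inv_le_rate_sq {r : ℝ} (hr : 0 < r) {n : ℕ} {lam : ℝ} (hlam : 0 < lam) (hlam1 : lam ≤ 1) :
    (n : ℝ)⁻¹ ≤ rate r n lam ^ 2 := by
  refine le_trans ?_ (inv_mul_rpow_le_rate_sq hlam)
  exact le_mul_of_one_le_right (by positivity)
    (Real.one_le_rpow_of_pos_of_le_one_of_nonpos hlam hlam1 (by simp; positivity))

theorem le_rate_sq {r : ℝ} {n : ℕ} {lam : ℝ} (hlam : 0 < lam) : lam ≤ rate r n lam ^ 2 := by
  have h1 : lam = (lam ^ (1 / 2 : ℝ)) ^ 2 := by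
    rw [← Real.rpow_natCast, ← Real.rpow_mul hlam.le]; norm_num
  conv_lhs => rw [h1]
  exact pow_le_pow_left₀ (by positivity) (le_add_of_nonneg_left (by positivity)) 2

theorem tendsto_rate {r : ℝ} {lam : ℕ → ℝ} (hlam : ∀ n, 0 < lam n)
    (hlam0 : Tendsto lam atTop (𝓝 0))
    (hnlam : Tendsto (fun n : ℕ => (n : ℝ) * lam n ^ (1 / r)) atTop atTop) :
    Tendsto (fun n => rate r n (lam n)) atTop (𝓝 0) := by
  have h1 : Tendsto (fun n => lam n ^ (1 / 2 : ℝ)) atTop (𝓝 0) := by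
    have := hlam0.rpow_const (p := 1 / 2) (Or.inr (by norm_num))
    simpa using this
  have h2 : Tendsto (fun n : ℕ => ((n : ℝ) * lam n ^ (1 / r)) ^ (-(1 / 2) : ℝ)) atTop (𝓝 0) :=
    (tendsto_rpow_neg_atTop (by norm_num : (0 : ℝ) < 1 / 2)).comp hnlam
  have h3 : ∀ n : ℕ, ((n : ℝ) * lam n ^ (1 / r)) ^ (-(1 / 2) : ℝ) =
      (n : ℝ) ^ (-(1 / 2) : ℝ) * lam n ^ (-(1 / (2 * r))) := fun n => by
    rw [Real.mul_rpow (by positivity) (Real.rpow_nonneg (hlam n).le _), ← Real.rpow_mul (hlam n).le]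
    congr 2
    rw [one_div, one_div, one_div, mul_inv]; ring
  simp_rw [h3] at h2
  simpa [rate] using h2.add h1

/-- The empirical mean as a continuous functional on a reproducing kernel Hilbert space. -/
noncomputable def empCLM {𝒳 : Type*} (H : Type*) [NormedAddCommGroup H] [InnerProductSpace ℝ H]
    [RKHS ℝ H 𝒳 ℝ] (x : ℕ → 𝒳) (n : ℕ) : H →L[ℝ] ℝ :=
  (n : ℝ)⁻¹ • ∑ i ∈ Finset.range n,
    (ContinuousLinearMap.proj (R := ℝ) (φ := fun _ : 𝒳 => ℝ) (x i)).comp (RKHS.coeCLM ℝ)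

theorem empCLM_apply {𝒳 H : Type*} [NormedAddCommGroup H] [InnerProductSpace ℝ H]
    [RKHS ℝ H 𝒳 ℝ] (x : ℕ → 𝒳) (n : ℕ) (g : H) :
    empCLM H x n g = empMean x n (fun y => g y) := by
  simp [empCLM, empMean]

/-! ### The stochastic bound. -/

-- On the p-sphere of radius d = M₀ δ, with δ the rate, the curvature contributes c₂ d² while the
-- noise is of order δ d plus a net error. A large M₀ makes the former win outside events of small
-- probability.
set_option maxHeartbeats 1600000 in
theorem isBigOp_normH {E H 𝒳 Ω : Type*} [NormedAddCommGroup E] [NormedSpace ℝ E]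
    [FiniteDimensional ℝ E] [MeasurableSpace 𝒳] [MeasurableSpace Ω]
    [NormedAddCommGroup H] [InnerProductSpace ℝ H] [RKHS ℝ H 𝒳 ℝ]
    {ν μ : Measure 𝒳} [IsProbabilityMeasure μ] {η : E × H → 𝒳 → ℝ} {τ₀ : E × H}
    (hη : ∀ τ, MemL20 μ (η τ)) {α : E → 𝒳 → ℝ} (hadd : ∀ θ (h : H) x, η (θ, h) x = α θ x + h x)
    {J : LinearMap.BilinForm ℝ H} (hJ : J.IsPosSemidef)
    {Lθ D : E →L[ℝ] L20 μ} {Lh ι : H →L[ℝ] L20 μ} (hL : OperatorCondition J Lθ Lh)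
    (hDι : OperatorCondition J D ι) (hι : ∀ g : H, L20fn (ι g) =ᵐ[μ] fun x => g x)
    {C₁ C₂ : ℝ} (hC₁ : 0 < C₁) (hC₂ : 0 < C₂)
    (hιL : ∀ g, C₁ * V (Lh g) ≤ V (ι g) ∧ V (ι g) ≤ C₂ * V (Lh g))
    (hD : HasFDerivAt (fun θ => (hη (θ, τ₀.2)).toL20) D τ₀.1)
    (hF : ContDiffAt ℝ 1 (fun θ => (hη (θ, τ₀.2)).toL20) τ₀.1)
    {Nθ : Set E} {Nh : Set H} (hNθ : IsOpen Nθ) (hτ₀ : τ₀ ∈ Nθ ×ˢ Nh)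
    (hlik : ∀ τ ∈ Nθ ×ˢ Nh, ∀ (x : ℕ → 𝒳) (n : ℕ),
      negLogLik ν η x n τ - negLogLik ν η x n τ₀ =
        Real.log (∫ y, Real.exp (η τ y - η τ₀ y) ∂μ) - empMean x n (fun y => η τ y - η τ₀ y))
    {M : ℝ} (hM : ∀ τ ∈ Nθ ×ˢ Nh, ∀ᵐ x ∂μ, |η τ x - η τ₀ x| ≤ M)
    {φ : ℕ → H} {ρ : ℕ → ℝ} (hφ : IsEigensystem J Lh φ ρ)
    {r : ℝ} (hr : 1 < r) (hρ : EigenvalueGrowth ρ r)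
    {P : Measure Ω} [IsProbabilityMeasure P] {X : ℕ → Ω → 𝒳}
    (hX : ∀ i, HasLaw (X i) μ P) (hindep : iIndepFun X P)
    {lam : ℕ → ℝ} (hlam : ∀ n, 0 < lam n) (hlam0 : Tendsto lam atTop (𝓝 0))
    (hnlam : Tendsto (fun n : ℕ => (n : ℝ) * lam n ^ (1 / r)) atTop atTop)
    {θhat : ℕ → Ω → E} {hhat : ℕ → Ω → H}
    (hest : Tendsto (fun n => P {ω | ¬ IsEstimator ν η J (Nθ ×ˢ Nh) (lam n) (fun i => X i ω) n
      (θhat n ω, hhat n ω)}) atTop (𝓝 0)) :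
    IsBigOp P (fun n ω => normH J ι (lam n) (hhat n ω - τ₀.2)) (fun n => rate r n (lam n)) := by
  classical
  set N := Nθ ×ˢ Nh with hN
  set F : E × H → L20 μ := fun τ => (hη τ).toL20 with hFdef
  set K : E × H → ℝ := fun τ => Real.log (∫ y, Real.exp (η τ y - η τ₀ y) ∂μ) with hKdef
  -- constants of the model
  obtain ⟨c₅, hc₅, hsep⟩ := hDι.exists_le
  have hι' : ∀ g : H, MemL20 μ (fun x => g x) := fun g =>
    ⟨(memLp_congr_ae (hι g)).1 (memL20_L20fn _).1, by
      rw [← integral_congr_ae (hι g)]; exact (memL20_L20fn _).2⟩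
  have haff : ∀ θ h g, F (θ, h + g) = F (θ, h) + ι g := by
    intro θ h g
    apply L20_ext
    have e : L20fn (F (θ, h) + ι g) =ᵐ[μ] fun x => L20fn (F (θ, h)) x + L20fn (ι g) x :=
      Lp.coeFn_add _ _
    filter_upwards [e, hι g, L20fn_toL20 (hη (θ, h)), L20fn_toL20 (hη (θ, h + g))] with x h1 h2 h3 h4
    rw [h1, h2, hFdef]
    simp only
    rw [h3, h4, hadd, hadd]
    simp [add_assoc]
  obtain ⟨r₁, hr₁, L, hLpos, hrN, hquad, hlip⟩ :=
    exists_local_bounds (F := F) haff hD hF hc₅ hsep (hNθ.mem_nhds hτ₀.1)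
  obtain ⟨R, hR, C, hC, hctrl⟩ := exists_finset_control_of_convexOn E
  have hnorm : ∀ τ τ', √(∫ y, (η τ y - η τ' y) ^ 2 ∂μ) = ‖F τ - F τ'‖ := fun τ τ' => by
    rw [hFdef]; simp only
    rw [← MemL20.toL20_sub, norm_toL20]
  have hnorm2 : ∀ τ τ', ∫ y, (η τ y - η τ' y) ^ 2 ∂μ = ‖F τ - F τ'‖ ^ 2 := fun τ τ' => by
    rw [← hnorm, Real.sq_sqrt (integral_nonneg fun _ => sq_nonneg _)]
  set A : ℝ := Real.exp M * L ^ 2 with hA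
  have hA0 : 0 < A := by positivity
  -- One 1/4 comes from the divergence bound, the other from squaring the factor 2 in `hquad`; the
  -- minimum with 1/2 accounts for the penalty.
  set c₁ : ℝ := Real.exp (-M) ^ 2 / 16 with hc₁
  set c₂ : ℝ := min c₁ (1 / 2) with hc₂
  have hc₁0 : 0 < c₁ := by positivity
  have hc₂0 : 0 < c₂ := by positivity
  have hc₂1 : c₂ ≤ c₁ := min_le_left _ _
  have hc₂2 : c₂ ≤ 1 / 2 := min_le_right _ _
  clear_value A c₂
  -- Separation bounds ζ, hence D ζ, by D ζ + ι g, so ι g alone is controlled by the sum.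
  set c₆ : ℝ := (1 + ‖D‖ / √c₅) ^ 2 with hc₆
  have hc₆1 : 1 ≤ c₆ := one_le_pow₀ (by have : 0 ≤ ‖D‖ / √c₅ := by positivity
                                        linarith)
  have hζle : ∀ ζ g, ‖ζ‖ ≤ ‖D ζ + ι g‖ / √c₅ := fun ζ g => by
    have := Real.sqrt_le_sqrt (hsep ζ g)
    rw [Real.sqrt_mul hc₅.le, Real.sqrt_sq (norm_nonneg _), Real.sqrt_sq (norm_nonneg _)] at this
    rw [le_div_iff₀ (by positivity)]
    linarith
  have hιle : ∀ ζ g, ‖ι g‖ ^ 2 ≤ c₆ * ‖D ζ + ι g‖ ^ 2 := fun ζ g => by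
    rw [hc₆, ← mul_pow]
    refine pow_le_pow_left₀ (norm_nonneg _) ?_ 2
    have h1 : ι g = (D ζ + ι g) - D ζ := by abel
    have h2 := norm_sub_le (D ζ + ι g) (D ζ)
    rw [← h1] at h2
    have h3 : ‖D ζ‖ ≤ ‖D‖ * (‖D ζ + ι g‖ / √c₅) := (D.le_opNorm ζ).trans (by gcongr; exact hζle ζ g)
    calc _ ≤ _ := h2
      _ ≤ ‖D ζ + ι g‖ + ‖D‖ * (‖D ζ + ι g‖ / √c₅) := by gcongr
      _ = _ := by ring
  -- The eigensystem belongs to `Lh`, the sphere to (D, ι); c₇ converts between the two norms.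
  set c₇ : ℝ := max (C₁⁻¹ * c₆) 1 with hc₇
  have hc₇1 : 1 ≤ c₇ := le_max_right _ _
  have hc₇2 : C₁⁻¹ * c₆ ≤ c₇ := le_max_left _ _
  clear_value c₆ c₇
  have hρ0 : ∀ i, 0 ≤ ρ i := fun i => by
    have := hφ.diagonal i i
    rw [if_pos rfl] at this
    rw [← this]; exact hJ.nonneg _
  obtain ⟨S, hS, hsum⟩ := tsum_inv_one_add_le hρ0 hr hρ
  -- Chosen so that the net error is at most (c₂/4) d². The mesh depends on neither n nor the
  -- probability level, so the number of test points is fixed.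
  set s : ℝ := min 1 (c₂ * c₅ / (8 * C * A * R)) with hs
  have hR0 : 0 < R := by linarith
  have hs0 : 0 < s := lt_min one_pos (by positivity)
  have hsle : C * s * (2 * A * R) ≤ c₂ / 4 * c₅ := by
    have h1 : s ≤ c₂ * c₅ / (8 * C * A * R) := min_le_right _ _
    calc C * s * (2 * A * R) ≤ C * (c₂ * c₅ / (8 * C * A * R)) * (2 * A * R) := by gcongr
      _ = _ := by field_simp; ring
  obtain ⟨T, hTR, hT⟩ := hctrl s hs0 (min_le_left _ _)
  clear_value s
  have hMτ₀ : MemL20 μ (η τ₀) := hη τ₀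
  -- analytic facts about the Kullback–Leibler divergence
  have hK0 : K τ₀ = 0 := by simp [hKdef]
  have hKlow : ∀ τ ∈ N, Real.exp (-M) ^ 2 / 4 * ‖F τ - F τ₀‖ ^ 2 ≤ K τ := fun τ hτ => by
    have := le_log_integral_exp ((hη τ).sub hMτ₀) (hM τ hτ)
    rwa [hnorm2] at this
  have hrN' : ∀ ζ : E, ‖ζ‖ ≤ r₁ → (τ₀.1 + ζ, τ₀.2) ∈ N := fun ζ hζ => ⟨hrN ζ hζ, hτ₀.2⟩
  have hKlip : ∀ ζ ζ' : E, ‖ζ‖ ≤ r₁ → ‖ζ'‖ ≤ r₁ →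
      |K (τ₀.1 + ζ, τ₀.2) - K (τ₀.1 + ζ', τ₀.2)| ≤ A * (‖ζ - ζ'‖ * (‖ζ‖ + ‖ζ'‖)) := by
    intro ζ ζ' hζ hζ'
    have h1 := abs_log_integral_exp_sub_le ((hη (τ₀.1 + ζ, τ₀.2)).sub hMτ₀)
      ((hη (τ₀.1 + ζ', τ₀.2)).sub hMτ₀) (hM _ (hrN' ζ hζ)) (hM _ (hrN' ζ' hζ'))
    simp only [sub_sub_sub_cancel_right] at h1
    rw [hnorm, hnorm, hnorm] at h1
    refine h1.trans ?_
    have h2 := hlip ζ ζ' hζ hζ'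
    have h0 : ‖(0 : E)‖ ≤ r₁ := by simpa using hr₁.le
    have h3 := hlip ζ 0 hζ h0
    have h4 := hlip ζ' 0 hζ' h0
    rw [add_zero, sub_zero] at h3 h4
    calc _ ≤ Real.exp M * ((L * ‖ζ - ζ'‖) * (L * ‖ζ‖ + L * ‖ζ'‖)) := by gcongr
      _ = _ := by rw [hA]; ring
  -- the probabilistic constants
  intro ε₀ hε₀
  -- The allowance is shared by one event per test point, the dual norm event and failure of the
  -- estimator. W and B below are the Markov and Chebyshev thresholds for this share.
  set v₀ : ℝ := ε₀ / (T.card + 2) with hv₀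
  have hv₀0 : 0 < v₀ := by positivity
  set W : ℝ := C₂ * S / v₀ with hW
  have hW0 : 0 < W := by positivity
  set B : ℝ := L * R / √(c₅ * v₀) with hB
  have hB0 : 0 < B := by positivity
  have hB2 : B ^ 2 = (L * R) ^ 2 / (c₅ * v₀) := by
    rw [hB, div_pow, Real.sq_sqrt (by positivity)]
  set a : ℝ := C * B + √(W * c₇) + √(J τ₀.2 τ₀.2) with ha
  have ha0 : 0 ≤ a := by positivity
  -- Ensures a ≤ (c₂/2) M₀, so the noise terms of order δ d cost at most (c₂/2) d².
  set M₀ : ℝ := 2 * a / c₂ + 1 with hM₀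
  have hM₀0 : 0 < M₀ := by positivity
  clear_value v₀ W B a M₀
  refine ⟨√c₆ * M₀, by positivity, ?_⟩
  -- Eventually the sphere is so small that all rescaled test points stay in the neighbourhood of θ₀
  -- where the local bounds hold.
  have hev : ∀ᶠ n in atTop, rate r n (lam n) < √c₅ * r₁ / (R * M₀) :=
    (tendsto_rate hlam hlam0 hnlam).eventually_lt_const (by positivity)
  have hev1 : ∀ᶠ n in atTop, lam n < 1 := hlam0.eventually_lt_const one_pos
  have hev2 : ∀ᶠ n in atTop, P {ω | ¬ IsEstimator ν η J N (lam n) (fun i => X i ω) n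
      (θhat n ω, hhat n ω)} < ENNReal.ofReal v₀ :=
    hest.eventually_lt_const (by simpa using hv₀0)
  filter_upwards [hev, hev1, hev2] with n hn1 hn2 hn3
  have hl := hlam n
  set δ : ℝ := rate r n (lam n) with hδ
  have hδ0 : 0 < δ := rate_pos hl
  have hnδ : (n : ℝ)⁻¹ ≤ δ ^ 2 := inv_le_rate_sq (by linarith) hl hn2.le
  have hnlδ : (n : ℝ)⁻¹ * lam n ^ (-(1 / r)) ≤ δ ^ 2 := inv_mul_rpow_le_rate_sq hl
  have hlδ : lam n ≤ δ ^ 2 := le_rate_sq hl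
  set d : ℝ := M₀ * δ with hd
  have hd0 : 0 < d := by positivity
  set ε : ℝ := d / √c₅ with hε
  have hε0 : 0 < ε := by positivity
  have hεr : R * ε ≤ r₁ := by
    rw [lt_div_iff₀ (by positivity)] at hn1
    rw [hε, hd, mul_div_assoc', div_le_iff₀ (by positivity)]
    linarith
  have hε2 : ε ^ 2 = d ^ 2 / c₅ := by rw [hε, div_pow, Real.sq_sqrt hc₅.le]
  clear_value δ d ε
  set f : E → 𝒳 → ℝ := fun v y => η (τ₀.1 + ε • v, τ₀.2) y - η τ₀ y with hf
  set E₁ : Set Ω := {ω | ¬ IsEstimator ν η J N (lam n) (fun i => X i ω) n (θhat n ω, hhat n ω)}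
  set E₂ : Set Ω := {ω | ENNReal.ofReal (W * δ ^ 2) ≤ empDual (fun i => X i ω) n
    (fun i y => φ i y) (fun i => 1 + lam n * ρ i)}
  set E₃ : E → Set Ω := fun v => {ω | B * δ * d < |empMean (fun i => X i ω) n (f v)|}
  have hE₂ : P E₂ ≤ ENNReal.ofReal v₀ := by
    refine measure_le_empDual_le hX hindep (fun i => hι' (φ i)) (C := C₂)
      (S := S * lam n ^ (-(1 / r))) (fun i => ?_) hC₂.le (hsum _ hl hn2.le) n (by positivity) ?_
    · have h1 : ∫ x, φ i x ^ 2 ∂μ = V (ι (φ i)) := by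
        rw [V_eq_integral]
        refine integral_congr_ae ?_
        filter_upwards [hι (φ i)] with x hx
        rw [hx]
      have h2 : V (Lh (φ i)) = 1 := by
        have := hφ.orthonormal i i
        rwa [if_pos rfl, Vcov_eq_inner, real_inner_self_eq_norm_sq, ← V_eq_norm_sq] at this
      rw [h1]
      simpa [h2] using (hιL (φ i)).2
    · calc (n : ℝ)⁻¹ * C₂ * (S * lam n ^ (-(1 / r)))
          = C₂ * S * ((n : ℝ)⁻¹ * lam n ^ (-(1 / r))) := by ring
        _ ≤ C₂ * S * δ ^ 2 := by gcongr
        _ = v₀ * (W * δ ^ 2) := by rw [hW]; field_simp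
  have hE₃ : ∀ v ∈ T, P (E₃ v) ≤ ENNReal.ofReal v₀ := by
    intro v hv
    refine measure_lt_abs_empMean_le hX hindep ((hη _).sub hMτ₀) n (by positivity) ?_
    rw [hnorm2]
    have h0 : ‖(0 : E)‖ ≤ r₁ := by simpa using hr₁.le
    have hvε : ‖ε • v‖ ≤ R * ε := by
      rw [norm_smul, Real.norm_of_nonneg hε0.le, mul_comm]
      gcongr
      exact hTR v hv
    have h3 := hlip (ε • v) 0 (hvε.trans hεr) h0
    rw [add_zero, sub_zero] at h3
    have h4 : ‖F (τ₀.1 + ε • v, τ₀.2) - F τ₀‖ ≤ L * (R * ε) := h3.trans (by gcongr)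
    calc _ ≤ δ ^ 2 * (L * (R * ε)) ^ 2 := by
          gcongr
      _ = v₀ * (B * δ * d) ^ 2 := by
          rw [mul_pow L, mul_pow R, hε2, mul_pow (B * δ), mul_pow B, hB2]
          field_simp
  have hincl : {ω | √c₆ * M₀ * δ < |normH J ι (lam n) (hhat n ω - τ₀.2)|} ⊆
      E₁ ∪ (E₂ ∪ ⋃ v ∈ T, E₃ v) := by
    intro ω hω
    by_contra hnot
    simp only [Set.mem_union, not_or, Set.mem_iUnion, exists_prop, not_exists, not_and] at hnot
    obtain ⟨h1, h2, h3⟩ := hnot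
    have hestim : IsEstimator ν η J N (lam n) (fun i => X i ω) n (θhat n ω, hhat n ω) := not_not.1 h1
    have hdual : empDual (fun i => X i ω) n (fun i y => φ i y) (fun i => 1 + lam n * ρ i) ≤
        ENNReal.ofReal (W * δ ^ 2) := (not_le.1 h2).le
    have htest : ∀ v ∈ T, |empMean (fun i => X i ω) n (f v)| ≤ B * δ * d :=
      fun v hv => not_lt.1 (h3 v hv)
    have hJnn : ∀ g, 0 ≤ lam n * J g g := fun g => mul_nonneg hl.le (hJ.nonneg g)
    have hDle : ∀ v : E × H, ‖D v.1 + ι v.2‖ ^ 2 + lam n * J v.2 v.2 = d ^ 2 →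
        ‖v.1‖ ≤ ε := fun v hv => by
      refine (hζle v.1 v.2).trans ?_
      rw [hε]
      gcongr
      exact abs_le_of_sq_le_sq' (by linarith [hJnn v.2]) hd0.le |>.2
    have hεr₁ : ε ≤ r₁ := (le_mul_of_one_le_left hε0.le hR).trans hεr
    have hlow : ∀ v : E × H, τ₀ + v ∈ N → ‖D v.1 + ι v.2‖ ^ 2 + lam n * J v.2 v.2 = d ^ 2 →
        c₂ * d ^ 2 ≤ K (τ₀ + v) + lam n / 2 * J v.2 v.2 := by
      intro v hv hvd
      have k1 := hKlow _ hv
      have k2 : ‖D v.1 + ι v.2‖ ≤ 2 * ‖F (τ₀ + v) - F τ₀‖ :=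
        hquad v.1 v.2 ((hDle v hvd).trans hεr₁)
      have k3 : ‖D v.1 + ι v.2‖ ^ 2 ≤ 4 * ‖F (τ₀ + v) - F τ₀‖ ^ 2 := by
        calc _ ≤ (2 * ‖F (τ₀ + v) - F τ₀‖) ^ 2 := by gcongr
          _ = _ := by ring
      have k4 : c₁ * ‖D v.1 + ι v.2‖ ^ 2 ≤ K (τ₀ + v) := by
        calc _ ≤ c₁ * (4 * ‖F (τ₀ + v) - F τ₀‖ ^ 2) := by gcongr
          _ = Real.exp (-M) ^ 2 / 4 * ‖F (τ₀ + v) - F τ₀‖ ^ 2 := by rw [hc₁]; ring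
          _ ≤ _ := k1
      have k5 : c₂ * ‖D v.1 + ι v.2‖ ^ 2 ≤ c₁ * ‖D v.1 + ι v.2‖ ^ 2 := by
        gcongr
      have k6 : c₂ * (lam n * J v.2 v.2) ≤ 1 / 2 * (lam n * J v.2 v.2) :=
        mul_le_mul_of_nonneg_right hc₂2 (hJnn _)
      rw [← hvd]
      linarith
    have hemp : ∀ v : E × H, τ₀ + v ∈ N → ‖D v.1 + ι v.2‖ ^ 2 + lam n * J v.2 v.2 = d ^ 2 →
        |empMean (fun i => X i ω) n (fun y => η (τ₀ + v) y - η τ₀ y)| +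
          |lam n * J τ₀.2 v.2| < c₂ * d ^ 2 := by
      intro v hv hvd
      have e1 : empMean (fun i => X i ω) n (fun y => η (τ₀ + v) y - η τ₀ y) =
          empMean (fun i => X i ω) n (fun y => η (τ₀.1 + v.1, τ₀.2) y - η τ₀ y) +
            empMean (fun i => X i ω) n (fun y => v.2 y) := by
        simp only [empMean, ← mul_add, ← Finset.sum_add_distrib]
        congr 1
        refine Finset.sum_congr rfl fun i _ => ?_
        have e2 : τ₀ + v = (τ₀.1 + v.1, τ₀.2 + v.2) := rfl
        rw [e2, hadd (τ₀.1 + v.1) (τ₀.2 + v.2), hadd (τ₀.1 + v.1) τ₀.2]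
        simp only [RKHS.coe_add, Pi.add_apply]
        ring
      have p1 : |empMean (fun i => X i ω) n (fun y => η (τ₀.1 + v.1, τ₀.2) y - η τ₀ y)| ≤
          C * (B * δ * d + s * (2 * A * R * ε ^ 2)) :=
        abs_empMean_le_of_test_points (θ₀ := τ₀.1) (h₀ := τ₀.2) (K := K) hestim.convexOn
          (fun τ hτ => hlik τ hτ _ _) hK0 hA0.le hrN' hKlip hR hT hε0 hεr (by positivity) htest
          (hDle v hvd)
      have p1' : C * (s * (2 * A * R * ε ^ 2)) ≤ c₂ / 4 * d ^ 2 := by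
        rw [hε2]
        calc C * (s * (2 * A * R * (d ^ 2 / c₅))) = C * s * (2 * A * R) * (d ^ 2 / c₅) := by ring
          _ ≤ c₂ / 4 * c₅ * (d ^ 2 / c₅) := by gcongr
          _ = _ := by field_simp
      have p2 : |empMean (fun i => X i ω) n (fun y => v.2 y)| ≤ √(W * c₇) * δ * d := by
        refine abs_le_of_sq_le_sq ?_ (by positivity)
        have q1 := hφ.sq_le hL hJ hl (empCLM H (fun i => X i ω) n) (w := W * δ ^ 2)
          (by positivity) (by simpa only [empCLM_apply, empDual] using hdual) v.2
        rw [empCLM_apply] at q1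
        have q2 : V (Lh v.2) ≤ C₁⁻¹ * c₆ * ‖D v.1 + ι v.2‖ ^ 2 := by
          have := (hιL v.2).1
          have q3 := hιle v.1 v.2
          rw [V_eq_norm_sq (ι v.2)] at this
          rw [mul_assoc, ← div_eq_inv_mul, le_div_iff₀ hC₁]
          linarith
        have q4 : V (Lh v.2) + lam n * J v.2 v.2 ≤ c₇ * d ^ 2 := by
          rw [← hvd, mul_add]
          refine add_le_add (q2.trans ?_) ?_
          · gcongr
          · exact le_mul_of_one_le_left (hJnn _) hc₇1
        calc _ ≤ _ := q1
          _ ≤ W * δ ^ 2 * (c₇ * d ^ 2) := by gcongr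
          _ = _ := by rw [mul_pow, mul_pow, Real.sq_sqrt (by positivity)]; ring
      have p3 : |lam n * J τ₀.2 v.2| ≤ √(J τ₀.2 τ₀.2) * δ * d := by
        refine abs_le_of_sq_le_sq ?_ (by positivity)
        have q1 := sq_apply_le_of_isPosSemidef hJ τ₀.2 v.2
        have q2 : lam n * J v.2 v.2 ≤ d ^ 2 := by linarith [sq_nonneg ‖D v.1 + ι v.2‖]
        have q4 := hJ.nonneg τ₀.2
        calc (lam n * J τ₀.2 v.2) ^ 2 = lam n ^ 2 * J τ₀.2 v.2 ^ 2 := by ring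
          _ ≤ lam n ^ 2 * (J τ₀.2 τ₀.2 * J v.2 v.2) := by gcongr
          _ = J τ₀.2 τ₀.2 * lam n * (lam n * J v.2 v.2) := by ring
          _ ≤ J τ₀.2 τ₀.2 * δ ^ 2 * d ^ 2 := by
              have := hJnn v.2
              gcongr
          _ = _ := by rw [mul_pow, mul_pow, Real.sq_sqrt q4]
      rw [e1]
      have p4 := abs_add_le (empMean (fun i => X i ω) n
        (fun y => η (τ₀.1 + v.1, τ₀.2) y - η τ₀ y)) (empMean (fun i => X i ω) n (fun y => v.2 y))
      have p5 : a * δ * d ≤ c₂ / 2 * d ^ 2 := by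
        have : a ≤ c₂ / 2 * M₀ := by
          have : c₂ / 2 * M₀ = a + c₂ / 2 := by rw [hM₀]; field_simp
          linarith
        calc a * δ * d ≤ c₂ / 2 * M₀ * δ * d := by gcongr
          _ = _ := by rw [hd]; ring
      have p6 : 0 < c₂ * d ^ 2 := by positivity
      have p7 : a * δ * d = C * (B * δ * d) + √(W * c₇) * δ * d + √(J τ₀.2 τ₀.2) * δ * d := by
        rw [ha]; ring
      rw [mul_add] at p1
      linarith
    have hle := hestim.sqrt_le hJ hl hτ₀ (D := D) (ι := ι) (fun τ hτ => hlik τ hτ _ _) hd0.le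
      hlow hemp
    set v : E × H := (θhat n ω, hhat n ω) - τ₀ with hv
    have hfinal : normH J ι (lam n) v.2 ≤ √c₆ * d := by
      refine le_trans ?_ (mul_le_mul_of_nonneg_left hle (Real.sqrt_nonneg _))
      rw [← Real.sqrt_mul (by linarith), normH]
      apply Real.sqrt_le_sqrt
      rw [V_eq_norm_sq, mul_add]
      exact add_le_add (hιle v.1 v.2) (le_mul_of_one_le_left (hJnn _) hc₆1)
    have hω' : √c₆ * M₀ * δ < normH J ι (lam n) v.2 := by
      have : |normH J ι (lam n) v.2| = normH J ι (lam n) v.2 := abs_of_nonneg (Real.sqrt_nonneg _)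
      rw [← this]; exact hω
    rw [hd] at hfinal
    linarith
  calc _ ≤ P (E₁ ∪ (E₂ ∪ ⋃ v ∈ T, E₃ v)) := measure_mono hincl
    _ ≤ P E₁ + (P E₂ + ∑ v ∈ T, P (E₃ v)) :=
        (measure_union_le _ _).trans (add_le_add le_rfl ((measure_union_le _ _).trans
          (add_le_add le_rfl (measure_biUnion_finset_le _ _))))
    _ ≤ ENNReal.ofReal v₀ + (ENNReal.ofReal v₀ + ∑ _v ∈ T, ENNReal.ofReal v₀) := by
        gcongr with v hv
        exact hE₃ v hv
    _ = ENNReal.ofReal ε₀ := by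
        rw [Finset.sum_const, ← ENNReal.ofReal_nsmul, ← ENNReal.ofReal_add hv₀0.le (by positivity),
          ← ENNReal.ofReal_add hv₀0.le (by positivity)]
        congr 1
        rw [nsmul_eq_mul, hv₀]
        field_simp
        ring

end SemiparDensity

/-! ### Admissibility of the inclusion and conclusion. -/

open SemiparDensity in
theorem corollary2
    {p : ℕ} {𝒳 H Ω : Type*} [MeasurableSpace 𝒳] [MeasurableSpace Ω]
    [NormedAddCommGroup H] [InnerProductSpace ℝ H] [CompleteSpace H] [RKHS ℝ H 𝒳 ℝ]
    -- the reference measure `dx`, the model and the true parameter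
    (ν : Measure 𝒳)
    (η : EuclideanSpace ℝ (Fin p) × H → 𝒳 → ℝ)
    (τ₀ : EuclideanSpace ℝ (Fin p) × H)
    (hη : ∀ τ, MemL20 (ν.tilted (η τ₀)) (η τ))
    -- the model is additive
    (α : EuclideanSpace ℝ (Fin p) → 𝒳 → ℝ)
    (hadd : ∀ (θ : EuclideanSpace ℝ (Fin p)) (h : H) (x : 𝒳), η (θ, h) x = α θ x + h x)
    -- the penalty
    (J : LinearMap.BilinForm ℝ H) (hJ : PenaltyCondition J)
    -- the auxiliary operators
    (Lθ : EuclideanSpace ℝ (Fin p) →L[ℝ] L20 (ν.tilted (η τ₀)))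
    (Lh : H →L[ℝ] L20 (ν.tilted (η τ₀)))
    (hL : OperatorCondition J Lθ Lh)
    -- the neighbourhood of the true parameter and the conditions on it
    (Nθ : Set (EuclideanSpace ℝ (Fin p))) (Nh : Set H)
    (hNθ : IsOpen Nθ) (hNh : IsOpen Nh) (hτ₀ : τ₀ ∈ Nθ ×ˢ Nh) (hconv : Convex ℝ (Nθ ×ˢ Nh))
    (hmodel : ModelCondition ν η τ₀ (fun τ => (hη τ).toL20) (Nθ ×ˢ Nh))
    (C₁ C₂ : ℝ) (hC₁ : 0 < C₁) (hC₂ : 0 < C₂)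
    (hcomp : DerivComparison (fun τ => (hη τ).toL20) (Nθ ×ˢ Nh) Lθ Lh C₁ C₂)
    (hvariation : DerivVariation (fun τ => (hη τ).toL20) (Nθ ×ˢ Nh) Lθ Lh C₁)
    (hvar : VarianceComparison ν η τ₀ (Nθ ×ˢ Nh))
    -- the spectral conditions
    (hcc : CompletelyContinuous (fun g => V (Lh g)) (fun g => J g g))
    (φ : ℕ → H) (ρ : ℕ → ℝ) (hφ : IsEigensystem J Lh φ ρ)
    (r : ℝ) (hr : 1 < r) (hρ : EigenvalueGrowth ρ r)
    -- the i.i.d. sample from the true distribution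
    (P : Measure Ω) [IsProbabilityMeasure P] (X : ℕ → Ω → 𝒳)
    (hX : ∀ i, HasLaw (X i) (ν.tilted (η τ₀)) P) (hindep : iIndepFun X P)
    -- the smoothing parameters
    (lam : ℕ → ℝ) (hlam : ∀ n, 0 < lam n) (hlam0 : Tendsto lam atTop (𝓝 0))
    (hnlam : Tendsto (fun n : ℕ => (n : ℝ) * lam n ^ (1 / r)) atTop atTop)
    -- the estimator, with probability tending to one
    (θhat : ℕ → Ω → EuclideanSpace ℝ (Fin p)) (hhat : ℕ → Ω → H)
    (hest : Tendsto (fun n => P {ω | ¬ IsEstimator ν η J (Nθ ×ˢ Nh) (lam n) (fun i => X i ω) n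
      (θhat n ω, hhat n ω)}) atTop (𝓝 0)) :
    -- the inclusion of `H` into `L²₀` is an admissible choice of the operator `Lh`
    ∃ ι : H →L[ℝ] L20 (ν.tilted (η τ₀)),
      (∀ h : H, L20fn (ι h) =ᵐ[ν.tilted (η τ₀)] fun x => h x) ∧
      (∃ Lθ' : EuclideanSpace ℝ (Fin p) →L[ℝ] L20 (ν.tilted (η τ₀)),
        OperatorCondition J Lθ' ι ∧
        ∃ C₁' C₂' : ℝ, 0 < C₁' ∧ 0 < C₂' ∧
          DerivComparison (fun τ => (hη τ).toL20) (Nθ ×ˢ Nh) Lθ' ι C₁' C₂') ∧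
      CompletelyContinuous (fun g => V (ι g)) (fun g => J g g) ∧
      -- the rate, in the norm of `H` that is given by this choice
      (∀ (n : ℕ) (ω : Ω), normH J ι (lam n) (hhat n ω - τ₀.2) =
        √(Var[fun x => hhat n ω x - τ₀.2 x; ν.tilted (η τ₀)]
          + lam n * J (hhat n ω - τ₀.2) (hhat n ω - τ₀.2))) ∧
      IsBigOp P (fun n ω => normH J ι (lam n) (hhat n ω - τ₀.2))
        (fun n => (n : ℝ) ^ (-(1 / 2) : ℝ) * lam n ^ (-(1 / (2 * r))) + lam n ^ (1 / 2 : ℝ)) := by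
  have hprob : IsProbabilityMeasure (ν.tilted (η τ₀)) :=
    (hX 0).isProbabilityMeasure_iff.1 inferInstance
  have hν : NeZero ν := ⟨fun h => by
    have := hprob.measure_univ
    simp [h] at this⟩
  set F : EuclideanSpace ℝ (Fin p) × H → L20 (ν.tilted (η τ₀)) := fun τ => (hη τ).toL20 with hF
  have hNopen : IsOpen (Nθ ×ˢ Nh) := hNθ.prod hNh
  have hFc : ∀ τ ∈ Nθ ×ˢ Nh, ContDiffAt ℝ 3 F τ := fun τ hτ =>
    hmodel.contDiffOn.contDiffAt (hNopen.mem_nhds hτ)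
  have hFd : ∀ τ ∈ Nθ ×ˢ Nh, DifferentiableAt ℝ F τ := fun τ hτ =>
    (hFc τ hτ).differentiableAt (by norm_num)
  -- By additivity, g is the difference of two values of η, hence centred and square integrable.
  have hmem : ∀ g : H, MemL20 (ν.tilted (η τ₀)) (fun x => g x) := fun g => by
    have h := (hη (τ₀.1, g)).sub (hη (τ₀.1, 0))
    have e : (fun x => η (τ₀.1, g) x - η (τ₀.1, 0) x) = fun x => g x := by
      ext x; rw [hadd, hadd]; simp
    rwa [e] at h
  let ι₀ : H →ₗ[ℝ] L20 (ν.tilted (η τ₀)) :=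
    { toFun := fun g => (hmem g).toL20
      map_add' := fun g h => Subtype.ext <|
        (MemLp.toLp_congr (hmem (g + h)).1 ((hmem g).1.add (hmem h).1)
          (ae_of_all _ fun x => by simp)).trans (MemLp.toLp_add (hmem g).1 (hmem h).1)
      map_smul' := fun c g => Subtype.ext <|
        (MemLp.toLp_congr (hmem (c • g)).1 ((hmem g).1.const_smul c)
          (ae_of_all _ fun x => by simp)).trans (MemLp.toLp_const_smul c (hmem g).1) }
  have haff : ∀ θ h g, F (θ, h + g) = F (θ, h) + ι₀ g := by
    intro θ h g
    have e : η (θ, h + g) = η (θ, h) + fun x => g x := by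
      ext x
      simp only [Pi.add_apply, hadd, RKHS.coe_add]
      ring
    refine Subtype.ext ?_
    change (hη (θ, h + g)).1.toLp _ = (hη (θ, h)).1.toLp _ + (hmem g).1.toLp _
    rw [← MemLp.toLp_add]
    exact MemLp.toLp_congr _ _ (by rw [e])
  have hDh : ∀ τ ∈ Nθ ×ˢ Nh, ∀ g, Dh F τ g = ι₀ g := fun τ hτ g =>
    Dh_apply_of_affine haff (hFd τ hτ) g
  -- Taking the Fréchet derivative as the inclusion makes it a continuous linear map by
  -- construction; its companion is the derivative in θ at the same point.
  set ι := Dh F τ₀ with hιdef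
  set D := Dθ F τ₀ with hDdef
  have hι : ∀ h : H, L20fn (ι h) =ᵐ[ν.tilted (η τ₀)] fun x => h x := fun h => by
    rw [hDh τ₀ hτ₀]; exact L20fn_toL20 (hmem h)
  have hcomp₀ := hcomp τ₀ hτ₀
  have hDι : OperatorCondition J D ι := hL.of_equiv hJ.1 hC₁ hC₂ hcomp₀
  have hιL : ∀ g, C₁ * V (Lh g) ≤ V (ι g) ∧ V (ι g) ≤ C₂ * V (Lh g) := fun g => by
    simpa using hcomp₀ 0 g
  have hexp := hmodel.integrable_exp
  -- A normalized eigenfunction shows that the true distribution is not trivial.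
  have hV₀ : V (Lh (φ 0)) ≠ 0 := by
    have := hφ.orthonormal 0 0
    rw [if_pos rfl, Vcov_eq_inner, real_inner_self_eq_norm_sq, ← V_eq_norm_sq] at this
    rw [this]; exact one_ne_zero
  obtain ⟨B, hB, hB0, hB1⟩ := exists_measurableSet_of_V_ne_zero hV₀
  obtain ⟨C₃, C₄, hC₃, hC₄, hvar'⟩ := hvar
  obtain ⟨M, hM⟩ := exists_ae_abs_le_of_variance_comparison hB hB0 hB1 hC₃ hC₄
  have hMN : ∀ τ ∈ Nθ ×ˢ Nh, ∀ᵐ x ∂(ν.tilted (η τ₀)), |η τ x - η τ₀ x| ≤ M := by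
    intro τ hτ
    refine hM _ ((hη τ).sub (hη τ₀)) ?_ fun f => ?_
    · rw [integrable_tilted_iff (hexp τ₀ hτ₀)]
      refine (hexp τ hτ).congr (ae_of_all _ fun x => ?_)
      simp only [smul_eq_mul]
      rw [← Real.exp_add]; congr 1; ring
    -- The model distribution at τ is the true one tilted by η(τ) - η(τ₀), so the variance
    -- comparison becomes one for tilts of the truth.
    · have e : (ν.tilted (η τ₀)).tilted (fun x => η τ x - η τ₀ x) = ν.tilted (η τ) := by
        rw [tilted_tilted (hexp τ₀ hτ₀)]
        congr 1
        ext x; simp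
      rw [e]
      exact (hvar' τ hτ f).2
  have hD : HasFDerivAt (fun θ => F (θ, τ₀.2)) D τ₀.1 := hasFDerivAt_Dθ (hFd τ₀ hτ₀)
  have hF1 : ContDiffAt ℝ 1 (fun θ => F (θ, τ₀.2)) τ₀.1 :=
    ContDiffAt.comp τ₀.1 ((hFc τ₀ hτ₀).of_le (by norm_num))
      (contDiffAt_id.prodMk contDiffAt_const)
  -- The ratios arise by comparing the derivative at τ with the one at τ₀ through (`Lθ`, `Lh`).
  refine ⟨ι, hι, ⟨D, hDι, C₁ / C₂, C₂ / C₁, by positivity, by positivity, fun τ hτ ζ g => ?_⟩,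
    hcc.of_le hC₂ fun g => (hιL g).2, fun n ω => ?_, ?_⟩
  · obtain ⟨h1, h2⟩ := hcomp τ hτ ζ g
    obtain ⟨h3, h4⟩ := hcomp₀ ζ g
    constructor
    · calc C₁ / C₂ * V (D ζ + ι g) ≤ C₁ / C₂ * (C₂ * V (Lθ ζ + Lh g)) := by gcongr
        _ = C₁ * V (Lθ ζ + Lh g) := by field_simp
        _ ≤ _ := h1
    · calc _ ≤ C₂ * V (Lθ ζ + Lh g) := h2
        _ = C₂ / C₁ * (C₁ * V (Lθ ζ + Lh g)) := by field_simp
        _ ≤ C₂ / C₁ * V (D ζ + ι g) := by gcongr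
  · have e : Var[L20fn (ι (hhat n ω - τ₀.2)); ν.tilted (η τ₀)] =
        Var[fun x => hhat n ω x - τ₀.2 x; ν.tilted (η τ₀)] := by
      refine variance_congr ?_
      filter_upwards [hι (hhat n ω - τ₀.2)] with x hx
      rw [hx, RKHS.coe_sub, Pi.sub_apply]
    rw [normH, V, e]
  · exact isBigOp_normH hη hadd hJ.1 hL hDι hι hC₁ hC₂ hιL hD hF1 hNθ hτ₀
      (fun τ hτ x n => negLogLik_sub (hexp τ hτ) (hexp τ₀ hτ₀) x n) hMN hφ hr hρ hX hindep hlam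
      hlam0 hnlam hest
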